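/- An orthogonal polyhedron is a connected 3-manifold with boundary in $\mathbb R^3$ that is a union of finitely many cuboids with edges parallel to the coordinate axes. A reflex edge is a maximal segment along which the interior dihedral angle is $3\pi/2$. Consider an orthogonal polyhedron $\mathcal S$ all of whose reflex edges are horizontal. It is partitioned into bricks, i.e. maximal cuboids any two of which are disjoint or touch only at their top or bottom faces. The nonempty intersection of two distinct bricks, their contact rectangle, is called primitive if, of the two horizontal faces of these bricks that meet there, one is contained in the other and exactly three of its four sides lie on sides of the other (so exactly one reflex edge borders the contact rectangle). $\mathcal S$ is called a stack if all its contact rectangles are primitive. Two points see each other in $\mathcal S$ if the segment joining them lies in $\mathcal S$. A set of reflex edges guards $\mathcal S$ with closed (respectively open) guards if every point of $\mathcal S$ is seen by a point of at least one of these edges, endpoints included (respectively excluded). **Lemma.** Let $\mathcal S$ be a stack with $r>0$ reflex edges, and let $g$ be its genus, i.e. the genus of its boundary surface. Then $\mathcal S$ can be guarded by at most $$\left\lfloor \frac{r-g}{2}\right\rfloor+1$$ open reflex edge guards, and likewise by at most this many closed reflex edge guards. -/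

import Mathlib

namespace StackGuard

/-- Points of space; coordinate `2` is the vertical one, coordinates `0` and `1` are horizontal. -/
abbrev Point : Type := Fin 3 → ℝ

/-- An axis-parallel (nondegenerate) cuboid; as a set of points we always use `Box.Icc`. -/
abbrev Box : Type := BoxIntegral.Box (Fin 3)

/-- An orthogonal polyhedron: a connected 3-manifold with boundary in space that is the union of
finitely many axis-parallel boxes. -/
structure IsOrthogonalPolyhedron (P : Set Point) : Prop where
  union_boxes : ∃ 𝓑 : Finset Box, P = ⋃ B ∈ 𝓑, BoxIntegral.Box.Icc B
  connected : IsConnected P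
  manifold : Nonempty (ChartedSpace (EuclideanHalfSpace 3) P)

/-- Near `p`, the set `P` is the complement of one open quadrant times the line of direction `i`
through `p`, so that the interior dihedral angle of `P` along this line at `p` is `3π/2`. -/
def IsReflexPoint (P : Set Point) (i : Fin 3) (p : Point) : Prop :=
  ∃ j k : Fin 3, j ≠ i ∧ k ≠ i ∧ j ≠ k ∧
    ∃ s t : ℝ, (s = 1 ∨ s = -1) ∧ (t = 1 ∨ t = -1) ∧
      ∀ᶠ q in nhds p, q ∈ P ↔ ¬ (0 < s * (q j - p j) ∧ 0 < t * (q k - p k))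

/-- The pair `e` consists of the two endpoints (in increasing order) of a reflex edge of `P`
parallel to the axis `i`: a maximal segment whose relative interior consists of reflex points. -/
structure IsReflexEdge (P : Set Point) (i : Fin 3) (e : Point × Point) : Prop where
  lt : e.1 i < e.2 i
  parallel : ∀ j, j ≠ i → e.1 j = e.2 j
  reflex : ∀ p ∈ openSegment ℝ e.1 e.2, IsReflexPoint P i p
  left_end : ¬ IsReflexPoint P i e.1
  right_end : ¬ IsReflexPoint P i e.2

/-- The set of all reflex edges of `P`, each given by its ordered pair of endpoints. -/
def reflexEdges (P : Set Point) : Set (Point × Point) :=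
  {e | ∃ i, IsReflexEdge P i e}

/-- A 2-reflex orthogonal polyhedron, oriented so that all its reflex edges are horizontal. -/
structure IsTwoReflex (P : Set Point) : Prop where
  polyhedron : IsOrthogonalPolyhedron P
  no_vertical : ∀ e, ¬ IsReflexEdge P 2 e

/-- The partition of `P` into bricks: finitely many cuboids that cover `P`, any two of which are
disjoint or touch at their top or bottom faces, and which are maximal, i.e. no two of them lie on
top of each other with the same horizontal section (they would merge into one cuboid). -/
structure IsBrickPartition (P : Set Point) (𝓑 : Finset Box) : Prop where
  cover : P = ⋃ B ∈ 𝓑, BoxIntegral.Box.Icc B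
  touch : ∀ B ∈ 𝓑, ∀ B' ∈ 𝓑, B ≠ B' →
    Disjoint (BoxIntegral.Box.Icc B) (BoxIntegral.Box.Icc B') ∨
      B.upper 2 = B'.lower 2 ∨ B'.upper 2 = B.lower 2
  maximal : ∀ B ∈ 𝓑, ∀ B' ∈ 𝓑, B.upper 2 = B'.lower 2 →
    ¬ ∀ i, i ≠ 2 → B.lower i = B'.lower i ∧ B.upper i = B'.upper i

/-- The contact rectangle of the touching bricks `B`, `B'` is primitive: the touching horizontal
face of one of them is contained in the one of the other and has exactly three sides flush with
it, so that the contact rectangle is bordered by exactly one reflex edge. -/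
def IsPrimitiveContact (B B' : Box) : Prop :=
  ∃ i j : Fin 3, i ≠ 2 ∧ j ≠ 2 ∧ i ≠ j ∧
    B.lower i = B'.lower i ∧ B.upper i = B'.upper i ∧
    ((B.lower j = B'.lower j ∧ B.upper j ≠ B'.upper j) ∨
      (B.lower j ≠ B'.lower j ∧ B.upper j = B'.upper j))

/-- A stack: a 2-reflex orthogonal polyhedron in whose partition into bricks every contact
rectangle (nonempty intersection of two different bricks) is primitive. -/
structure IsStack (P : Set Point) : Prop where
  twoReflex : IsTwoReflex P
  primitive : ∃ 𝓑 : Finset Box, IsBrickPartition P 𝓑 ∧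
    ∀ B ∈ 𝓑, ∀ B' ∈ 𝓑, B ≠ B' →
      (BoxIntegral.Box.Icc B ∩ BoxIntegral.Box.Icc B').Nonempty → IsPrimitiveContact B B'

open Classical in
/-- The cells of the subdivision of a segment by the finite set `X` of its points, each given by its
two endpoints: the points of `X` (equal endpoints) and the gaps between consecutive points. -/
noncomputable def lineCells (X : Finset ℝ) : Finset (ℝ × ℝ) :=
  (X ×ˢ X).filter fun c => c.1 ≤ c.2 ∧ ∀ x ∈ X, ¬ (c.1 < x ∧ x < c.2)

/-- The relatively open cell with the given coordinate endpoints (`openSegment ℝ a a = {a}`). -/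
def openCell (c : Fin 3 → ℝ × ℝ) : Set Point :=
  Set.univ.pi fun i => openSegment ℝ (c i).1 (c i).2

open Classical in
/-- The dimension of a cell. -/
noncomputable def cellDim (c : Fin 3 → ℝ × ℝ) : ℕ :=
  (Finset.univ.filter fun i => (c i).1 ≠ (c i).2).card

open Classical in
/-- The Euler characteristic (number of vertices minus number of edges plus number of squares) of
the boundary surface of `P`, subdivided by the grid with coordinate sets `X 0`, `X 1`, `X 2`. -/
noncomputable def boundaryEulerChar (P : Set Point) (X : Fin 3 → Finset ℝ) : ℤ :=
  ∑ c ∈ (Fintype.piFinset fun i => lineCells (X i)).filter fun c => openCell c ⊆ frontier P,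
    (-1) ^ cellDim c

/-- `P` is a union of finitely many boxes all of whose coordinates belong to the grid `X`; then the
boundary of `P` is a union of cells of the grid. -/
def IsGridFor (P : Set Point) (X : Fin 3 → Finset ℝ) : Prop :=
  ∃ 𝓑 : Finset Box, (∀ B ∈ 𝓑, ∀ i, B.lower i ∈ X i ∧ B.upper i ∈ X i) ∧
    P = ⋃ B ∈ 𝓑, BoxIntegral.Box.Icc B

/-- The genus of a polyhedron is the genus `g` of its boundary, a closed orientable surface, which
is determined by `χ = 2 - 2 g`. (The value of `χ` is the same for all grids. A stack has no
cavities: all horizontal sections of its complement are connected. So its boundary is connected.) -/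
def HasGenus (P : Set Point) (g : ℕ) : Prop :=
  ∃ X : Fin 3 → Finset ℝ, IsGridFor P X ∧ boundaryEulerChar P X = 2 - 2 * (g : ℤ)

/-- Two points see each other in `P` if the segment between them lies in `P`. -/
def Sees (P : Set Point) (x p : Point) : Prop :=
  segment ℝ x p ⊆ P

/-- Closed edge guards at the edges in `G` guard `P`. -/
def ClosedGuards (P : Set Point) (G : Finset (Point × Point)) : Prop :=
  ∀ p ∈ P, ∃ e ∈ G, ∃ x ∈ segment ℝ e.1 e.2, Sees P x p

/-- Open edge guards (deprived of their endpoints) at the edges in `G` guard `P`. -/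
def OpenGuards (P : Set Point) (G : Finset (Point × Point)) : Prop :=
  ∀ p ∈ P, ∃ e ∈ G, ∃ x ∈ openSegment ℝ e.1 e.2, Sees P x p

end StackGuard

/-! View the bricks as vertices of a graph whose edges are the contacts, each directed from the
brick with the larger horizontal section to the smaller one. Two counts reduce the claim to a
statement about this graph.

Every contact is bordered by its own reflex edge, so a stack with `b` bricks and `c` contacts has `c
≤ r`. By inclusion-exclusion the solid has Euler characteristic `b - c`, while its interior, counted
by open cells, has `c - b`. The boundary therefore has `2 * (b - c)`, and `b - c = 1 - g`. Hence `b
+ g ≤ r + 1`, and it suffices to find `(b + 1) / 2` guards (`IsStackPartition.exists_guards`).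

The contact graph is connected, so it has a subgraph `F` with all degrees odd, except perhaps for
one isolated vertex (`exists_odd_subgraph`). A larger neighbor covers a whole face of a brick, so a
brick with two larger neighbors has no other neighbor. Its degree in `F` would then be two, so each
brick has at most one parent in `F`, and `F` is a forest. Smaller neighbors on one face number at
most two, and two of them lie at opposite ends. With odd degrees, a brick with a parent has no child
or one such pair; a root has no child, one child, or a pair on one face and a single child on the
other.

A reflex edge crossing the vertical column over a brick sees all of that brick. Descending the
forest, such a guard continues into both children if they are narrower in the direction along the
edge. Otherwise one new guard per branching is enough, by a case distinction on the position of the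
guard (`IsBranching.exists_serves`). A root with three children needs just one guard beyond the
branching count; if all three are narrower in the same direction, this requires treating jointly two
branches on opposite faces that are flush at the same side (`IsBranching.exists_serves_opposite`).

Each tree thus costs one guard plus the sum of `⌊deg / 2⌋` over its bricks. As the degrees sum to
twice the number of non-roots and at most one is even, twice the total is at most `b + 1`. -/

namespace StackGuard

open BoxIntegral

/-! ### Subgraphs with odd degrees. -/

section OddSubgraph

variable {V : Type*} [DecidableEq V]

/-- The degree of `v` in the multigraph with edge set `F`. -/
def edgeDegree (F : Finset (V × V)) (v : V) : ℕ :=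
  ∑ e ∈ F, ((if e.1 = v then 1 else 0) + (if e.2 = v then 1 else 0))

theorem edgeDegree_insert {F : Finset (V × V)} {e : V × V} (he : e ∉ F) (v : V) :
    edgeDegree (insert e F) v =
      ((if e.1 = v then 1 else 0) + (if e.2 = v then 1 else 0)) + edgeDegree F v := by
  simp [edgeDegree, Finset.sum_insert he]

theorem edgeDegree_erase {F : Finset (V × V)} {e : V × V} (he : e ∈ F) (v : V) :
    edgeDegree F v =
      ((if e.1 = v then 1 else 0) + (if e.2 = v then 1 else 0)) + edgeDegree (F.erase e) v := by
  rw [edgeDegree, ← Finset.add_sum_erase _ _ he]; rfl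

theorem exists_toggle_edge {C F : Finset (V × V)} (hF : F ⊆ C) {e : V × V} (he : e ∈ C) :
    ∃ F' ⊆ C, ∀ w, (edgeDegree F' w + edgeDegree F w) % 2 =
      ((if e.1 = w then 1 else 0) + (if e.2 = w then 1 else 0)) % 2 := by
  by_cases h : e ∈ F
  · refine ⟨F.erase e, (Finset.erase_subset _ _).trans hF, fun w => ?_⟩
    rw [edgeDegree_erase h w]; omega
  · refine ⟨insert e F, Finset.insert_subset he hF, fun w => ?_⟩
    rw [edgeDegree_insert h w]; omega

/-- Toggling the edges of a walk one after another changes the parity at its two ends only, since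
the contributions at intermediate vertices cancel modulo 2. -/
theorem exists_toggle_path {C F : Finset (V × V)} (hF : F ⊆ C) {u v : V}
    (huv : Relation.ReflTransGen (fun u v => (u, v) ∈ C ∨ (v, u) ∈ C) u v) :
    ∃ F' ⊆ C, ∀ w, (edgeDegree F' w + edgeDegree F w) % 2 =
      ((if u = w then 1 else 0) + (if v = w then 1 else 0)) % 2 := by
  induction huv with
  | refl => exact ⟨F, hF, fun w => by omega⟩
  | @tail x y _ hxy ih =>
    obtain ⟨F₁, h₁, hd₁⟩ := ih
    obtain ⟨F₂, h₂, hd₂⟩ : ∃ F' ⊆ C, ∀ w, (edgeDegree F' w + edgeDegree F₁ w) % 2 =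
        ((if x = w then 1 else 0) + (if y = w then 1 else 0)) % 2 := by
      rcases hxy with h | h
      · exact exists_toggle_edge h₁ h
      · obtain ⟨F', h', hd'⟩ := exists_toggle_edge h₁ h
        exact ⟨F', h', fun w => by rw [hd' w, add_comm]⟩
    refine ⟨F₂, h₂, fun w => ?_⟩
    have := hd₁ w; have := hd₂ w; omega

/-- Take a subgraph with the fewest even vertices. If two were left, toggling a path between them
would make both odd and keep all other parities. -/
theorem exists_card_even_le_one (S : Finset V) (C : Finset (V × V))
    (hconn : ∀ u ∈ S, ∀ v ∈ S,
      Relation.ReflTransGen (fun u v => (u, v) ∈ C ∨ (v, u) ∈ C) u v) :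
    ∃ F ⊆ C, (S.filter fun v => Even (edgeDegree F v)).card ≤ 1 := by
  obtain ⟨F, hF, hmin⟩ := Finset.exists_min_image C.powerset
    (fun F => (S.filter fun v => Even (edgeDegree F v)).card) ⟨∅, by simp⟩
  rw [Finset.mem_powerset] at hF
  refine ⟨F, hF, ?_⟩
  by_contra! hlt
  obtain ⟨u, hu, v, hv, huv⟩ := Finset.one_lt_card.1 hlt
  rw [Finset.mem_filter] at hu hv
  obtain ⟨F', hF', hd⟩ := exists_toggle_path hF (hconn u hu.1 v hv.1)
  have := hmin F' (Finset.mem_powerset.2 hF')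
  refine absurd this (not_le.2 (Finset.card_lt_card ⟨fun w hw => ?_, fun hsub => ?_⟩))
  · rw [Finset.mem_filter] at hw ⊢
    refine ⟨hw.1, ?_⟩
    have := hd w
    rw [Nat.even_iff] at *
    have hu2 := hu.2; have hv2 := hv.2
    have hwu : u ≠ w := by
      rintro rfl
      rw [if_pos rfl, if_neg huv.symm] at this; omega
    have hwv : v ≠ w := by
      rintro rfl
      rw [if_neg huv, if_pos rfl] at this; omega
    rw [if_neg hwu, if_neg hwv] at this
    omega
  · have h1 := (Finset.mem_filter.1 (hsub (Finset.mem_filter.2 hu))).2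
    have h2 := hu.2
    have := hd u
    rw [if_pos rfl, if_neg huv.symm] at this
    rw [Nat.even_iff] at h1 h2
    omega

/-- A connected graph has a spanning subgraph all of whose degrees are odd, except for at most one
isolated vertex. -/
theorem exists_odd_subgraph (S : Finset V) (C : Finset (V × V))
    (hS : ∀ e ∈ C, e.1 ∈ S ∧ e.2 ∈ S ∧ e.1 ≠ e.2)
    (hconn : ∀ u ∈ S, ∀ v ∈ S,
      Relation.ReflTransGen (fun u v => (u, v) ∈ C ∨ (v, u) ∈ C) u v) :
    ∃ F ⊆ C, (S.filter fun v => Even (edgeDegree F v)).card ≤ 1 ∧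
      ∀ v ∈ S, Even (edgeDegree F v) → edgeDegree F v = 0 := by
  obtain ⟨F₀, hF₀, h₀⟩ := exists_card_even_le_one S C hconn
  -- Among the subgraphs with at most one even vertex, take one with fewest edges. If its even
  -- vertex had an edge, deleting that edge would make the vertex odd and at most the other endpoint
  -- even, contradicting minimality.
  obtain ⟨F, hF, hmin⟩ := Finset.exists_min_image
    (C.powerset.filter fun F => (S.filter fun v => Even (edgeDegree F v)).card ≤ 1)
    Finset.card ⟨F₀, by simp [hF₀, h₀]⟩
  rw [Finset.mem_filter, Finset.mem_powerset] at hF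
  refine ⟨F, hF.1, hF.2, fun v hv hev => ?_⟩
  by_contra hne
  obtain ⟨e, he, hev'⟩ := Finset.exists_ne_zero_of_sum_ne_zero hne
  have hinc : e.1 = v ∨ e.2 = v := by
    by_contra! h
    simp [h.1, h.2] at hev'
  obtain ⟨w, hw, hwv, hdeg⟩ : ∃ w ∈ S, w ≠ v ∧ ∀ x, edgeDegree F x =
      ((if v = x then 1 else 0) + (if w = x then 1 else 0)) + edgeDegree (F.erase e) x := by
    obtain ⟨h1, h2, h12⟩ := hS e (hF.1 he)
    rcases hinc with rfl | rfl
    · exact ⟨e.2, h2, h12.symm, fun x => edgeDegree_erase he x⟩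
    · exact ⟨e.1, h1, h12, fun x => by rw [edgeDegree_erase he x]; omega⟩
  have huniq : ∀ x ∈ S, Even (edgeDegree F x) → x = v := fun x hx hxe =>
    Finset.card_le_one.1 hF.2 x (by simp [hx, hxe]) v (by simp [hv, hev])
  have hle := hmin (F.erase e) (by
    rw [Finset.mem_filter, Finset.mem_powerset]
    refine ⟨(Finset.erase_subset _ _).trans hF.1, ?_⟩
    rw [Finset.card_le_one]
    have key : ∀ x ∈ S.filter fun v => Even (edgeDegree (F.erase e) v), x = w := by
      intro x hx
      rw [Finset.mem_filter] at hx
      by_contra hxw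
      have hd := hdeg x
      rw [if_neg (Ne.symm hxw)] at hd
      by_cases hxv : v = x
      · subst hxv
        rw [if_pos rfl] at hd
        have h2 := hx.2
        rw [Nat.even_iff] at h2 hev
        omega
      · rw [if_neg hxv] at hd
        refine hxv (huniq x hx.1 ?_).symm
        rw [hd]; simpa using hx.2
    intro a ha b hb
    rw [key a ha, key b hb])
  rw [Finset.card_erase_of_mem he] at hle
  have := Finset.card_pos.2 ⟨e, he⟩
  omega

theorem edgeDegree_eq_card (S : Finset V) (F : Finset (V × V))
    (hS : ∀ e ∈ F, e.1 ∈ S ∧ e.2 ∈ S) (v : V) :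
    edgeDegree F v = (S.filter fun a => (v, a) ∈ F).card + (S.filter fun u => (u, v) ∈ F).card := by
  unfold edgeDegree
  rw [Finset.sum_add_distrib, ← Finset.card_filter, ← Finset.card_filter]
  congr 1
  · refine Finset.card_nbij' (fun e => e.2) (fun a => (v, a)) ?_ ?_ ?_ ?_
    · rintro ⟨x, y⟩ h
      simp only [Finset.coe_filter, Set.mem_ofPred_eq] at h ⊢
      obtain ⟨h, rfl⟩ := h
      exact ⟨(hS _ h).2, h⟩
    · intro a h; simp at h ⊢; exact h.2
    · rintro ⟨x, y⟩ h; simp at h ⊢; exact h.2.symm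
    · intro a h; rfl
  · refine Finset.card_nbij' (fun e => e.1) (fun a => (a, v)) ?_ ?_ ?_ ?_
    · rintro ⟨x, y⟩ h
      simp only [Finset.coe_filter, Set.mem_ofPred_eq] at h ⊢
      obtain ⟨h, rfl⟩ := h
      exact ⟨(hS _ h).1, h⟩
    · intro a h; simp at h ⊢; exact h.2
    · rintro ⟨x, y⟩ h; simp at h ⊢; exact h.2.symm
    · intro a h; rfl

end OddSubgraph

/-- Weights accumulated over the descendants of a vertex. -/
theorem exists_accumulate {V : Type*} (rank : V → ℕ) (ch : V → Finset V)
    (h : ∀ v, ∀ c ∈ ch v, rank c < rank v) (k : V → ℕ) :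
    ∃ f : V → ℕ, ∀ v, f v = k v + ∑ c ∈ ch v, f c := by
  refine ⟨(measure rank).wf.fix fun v ih => k v + ∑ c ∈ (ch v).attach, ih c.1 (h v c.1 c.2), ?_⟩
  intro v
  rw [WellFounded.fix_eq]
  congr 1
  exact Finset.sum_attach (ch v) fun c => (measure rank).wf.fix
    (fun v ih => k v + ∑ c ∈ (ch v).attach, ih c.1 (h v c.1 c.2)) c

/-! ### Bricks, flush inclusions and contacts. -/

/-- The coordinate of the lower (`s = false`) or upper (`s = true`) side of `B` in direction `j`. -/
def side (B : Box) (j : Fin 3) (s : Bool) : ℝ := if s then B.upper j else B.lower j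

@[simp] theorem side_true (B : Box) (j : Fin 3) : side B j true = B.upper j := rfl

@[simp] theorem side_false (B : Box) (j : Fin 3) : side B j false = B.lower j := rfl

theorem mem_box {B : Box} {p : Point} :
    p ∈ Box.Icc B ↔ ∀ i, B.lower i ≤ p i ∧ p i ≤ B.upper i := by
  rw [Box.Icc_def, Set.mem_Icc, Pi.le_def, Pi.le_def, forall_and]

/-- The horizontal section of `a` is contained in the one of `v`: they have equal extents in one
horizontal direction, while in direction `j` they are flush at the side `s` and `a` is narrower. -/
structure FlushAt (v a : Box) (j : Fin 3) (s : Bool) : Prop where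
  horizontal : j ≠ 2
  other : ∀ i, i ≠ 2 → i ≠ j → v.lower i = a.lower i ∧ v.upper i = a.upper i
  flush : side a j s = side v j s
  lower_lt : v.lower j < side a j (!s)
  lt_upper : side a j (!s) < v.upper j

theorem FlushAt.lower_le {v a : Box} {j : Fin 3} {s : Bool} (h : FlushAt v a j s) {i : Fin 3}
    (hi : i ≠ 2) : v.lower i ≤ a.lower i := by
  by_cases hij : i = j
  · subst hij
    have h1 := h.flush; have h2 := h.lower_lt
    cases s <;> simp_all
    exact h2.le
  · exact (h.other i hi hij).1.le

theorem FlushAt.upper_le {v a : Box} {j : Fin 3} {s : Bool} (h : FlushAt v a j s) {i : Fin 3}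
    (hi : i ≠ 2) : a.upper i ≤ v.upper i := by
  by_cases hij : i = j
  · subst hij
    have h1 := h.flush; have h2 := h.lt_upper
    cases s <;> simp_all
    exact h2.le
  · exact (h.other i hi hij).2.ge

/-- The total horizontal extent of a box. -/
def girth (B : Box) : ℝ := (B.upper 0 - B.lower 0) + (B.upper 1 - B.lower 1)

/-- The strict monovariant that makes the orientation of contacts acyclic, and on which the
inductions over branches run. -/
theorem FlushAt.girth_lt {v a : Box} {j : Fin 3} {s : Bool} (h : FlushAt v a j s) :
    girth a < girth v := by
  have h0 := h.lower_le (i := 0) (by decide)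
  have h1 := h.lower_le (i := 1) (by decide)
  have h2 := h.upper_le (i := 0) (by decide)
  have h3 := h.upper_le (i := 1) (by decide)
  have h4 := h.lower_lt; have h5 := h.lt_upper
  have hj := h.horizontal
  unfold girth
  fin_cases j <;> cases s <;> simp_all <;> linarith

theorem FlushAt.not_symm {v a : Box} {j j' : Fin 3} {s s' : Bool} (h : FlushAt v a j s) :
    ¬ FlushAt a v j' s' := fun h' => lt_asymm h.girth_lt h'.girth_lt

theorem IsPrimitiveContact.flushAt {B B' : Box} (h : IsPrimitiveContact B B') :
    (∃ j s, FlushAt B B' j s) ∨ ∃ j s, FlushAt B' B j s := by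
  obtain ⟨i, j, hi, hj, hij, h1, h2, h3⟩ := h
  have oth : ∀ k : Fin 3, k ≠ 2 → k ≠ j → k = i := by omega
  have hB := B.lower_lt_upper j
  have hB' := B'.lower_lt_upper j
  rcases h3 with ⟨h3, h4⟩ | ⟨h3, h4⟩
  · rcases lt_or_gt_of_ne h4 with h | h
    · refine Or.inr ⟨j, false, hj, ?_, h3, ?_, ?_⟩
      · intro k hk hkj; obtain rfl := oth k hk hkj; exact ⟨h1.symm, h2.symm⟩
      · simp; linarith
      · simpa using h
    · refine Or.inl ⟨j, false, hj, ?_, h3.symm, ?_, ?_⟩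
      · intro k hk hkj; obtain rfl := oth k hk hkj; exact ⟨h1, h2⟩
      · simp; linarith
      · simpa using h
  · rcases lt_or_gt_of_ne h3 with h | h
    · refine Or.inl ⟨j, true, hj, ?_, h4.symm, ?_, ?_⟩
      · intro k hk hkj; obtain rfl := oth k hk hkj; exact ⟨h1, h2⟩
      · simpa using h
      · simp; linarith
    · refine Or.inr ⟨j, true, hj, ?_, h4, ?_, ?_⟩
      · intro k hk hkj; obtain rfl := oth k hk hkj; exact ⟨h1.symm, h2.symm⟩
      · simpa using h
      · simp; linarith

/-- `𝓑` is the partition of a stack into bricks. -/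
structure IsStackPartition (𝓑 : Finset Box) : Prop where
  touch : ∀ B ∈ 𝓑, ∀ B' ∈ 𝓑, B ≠ B' → (Box.Icc B ∩ Box.Icc B').Nonempty →
    B.upper 2 = B'.lower 2 ∨ B'.upper 2 = B.lower 2
  flush : ∀ B ∈ 𝓑, ∀ B' ∈ 𝓑, B ≠ B' → (Box.Icc B ∩ Box.Icc B').Nonempty →
    (∃ j s, FlushAt B B' j s) ∨ ∃ j s, FlushAt B' B j s

/-- The brick `a` touches the brick `v`, and its horizontal section is the smaller one. -/
structure IsContact (v a : Box) : Prop where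
  nonempty : (Box.Icc v ∩ Box.Icc a).Nonempty
  flush : ∃ j s, FlushAt v a j s

open Classical in
/-- The contacts of the bricks, as pairs of a larger and a smaller brick. -/
noncomputable def contacts (𝓑 : Finset Box) : Finset (Box × Box) :=
  (𝓑 ×ˢ 𝓑).filter fun e => IsContact e.1 e.2

open Classical in
/-- The height at which two touching bricks meet. -/
noncomputable def height (v a : Box) : ℝ := if v.upper 2 = a.lower 2 then v.upper 2 else v.lower 2

theorem mem_contacts {𝓑 : Finset Box} {v a : Box} :
    (v, a) ∈ contacts 𝓑 ↔ v ∈ 𝓑 ∧ a ∈ 𝓑 ∧ IsContact v a := by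
  simp [contacts, and_assoc]

namespace IsContact

variable {v a : Box}

theorem ne (h : IsContact v a) : v ≠ a := by
  rintro rfl
  obtain ⟨j, s, h⟩ := h.flush
  exact lt_irrefl _ h.girth_lt

theorem not_symm (h : IsContact v a) : ¬ IsContact a v := fun h' => by
  obtain ⟨j, s, h⟩ := h.flush
  obtain ⟨j, s, h'⟩ := h'.flush
  exact h.not_symm h'

theorem lower_le (h : IsContact v a) {i : Fin 3} (hi : i ≠ 2) : v.lower i ≤ a.lower i := by
  obtain ⟨j, s, h⟩ := h.flush
  exact h.lower_le hi

theorem upper_le (h : IsContact v a) {i : Fin 3} (hi : i ≠ 2) : a.upper i ≤ v.upper i := by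
  obtain ⟨j, s, h⟩ := h.flush
  exact h.upper_le hi

end IsContact

namespace IsStackPartition

variable {𝓑 : Finset Box} (h𝓑 : IsStackPartition 𝓑)
include h𝓑

theorem contact_or {B B' : Box} (hB : B ∈ 𝓑) (hB' : B' ∈ 𝓑) (hne : B ≠ B')
    (hn : (Box.Icc B ∩ Box.Icc B').Nonempty) :
    (B, B') ∈ contacts 𝓑 ∨ (B', B) ∈ contacts 𝓑 := by
  rw [mem_contacts, mem_contacts]
  rcases h𝓑.flush B hB B' hB' hne hn with h | h
  · exact Or.inl ⟨hB, hB', hn, h⟩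
  · exact Or.inr ⟨hB', hB, Set.inter_comm _ _ ▸ hn, h⟩

theorem height_spec {v a : Box} (h : (v, a) ∈ contacts 𝓑) :
    ∃ σ, side v 2 σ = height v a ∧ side a 2 (!σ) = height v a := by
  rw [mem_contacts] at h
  obtain ⟨hv, ha, hc⟩ := h
  unfold height
  split_ifs with h'
  · exact ⟨true, rfl, h'.symm⟩
  · refine ⟨false, rfl, ?_⟩
    rcases h𝓑.touch v hv a ha hc.ne hc.nonempty with h | h
    · exact absurd h h'
    · exact h

theorem height_mem_left {v a : Box} (h : (v, a) ∈ contacts 𝓑) :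
    v.lower 2 ≤ height v a ∧ height v a ≤ v.upper 2 := by
  obtain ⟨σ, h1, _⟩ := h𝓑.height_spec h
  have := (v.lower_lt_upper 2).le
  cases σ <;> simp at h1 <;> simp [← h1, this]

theorem height_mem_right {v a : Box} (h : (v, a) ∈ contacts 𝓑) :
    a.lower 2 ≤ height v a ∧ height v a ≤ a.upper 2 := by
  obtain ⟨σ, _, h1⟩ := h𝓑.height_spec h
  have := (a.lower_lt_upper 2).le
  cases σ <;> simp at h1 <;> simp [← h1, this]

theorem mem_contact_iff {v a : Box} (h : (v, a) ∈ contacts 𝓑) {p : Point} :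
    p ∈ Box.Icc v ∧ p ∈ Box.Icc a ↔
      (∀ i, i ≠ 2 → a.lower i ≤ p i ∧ p i ≤ a.upper i) ∧ p 2 = height v a := by
  have hl := h𝓑.height_mem_left h
  have hr := h𝓑.height_mem_right h
  obtain ⟨σ, h1, h2⟩ := h𝓑.height_spec h
  have hc := (mem_contacts.1 h).2.2
  rw [mem_box, mem_box]
  constructor
  · rintro ⟨hv, ha⟩
    refine ⟨fun i _ => ha i, ?_⟩
    have := hv 2; have := ha 2
    cases σ <;> simp at h1 h2 <;> linarith
  · rintro ⟨h3, h4⟩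
    refine ⟨fun i => ?_, fun i => ?_⟩
    · by_cases hi : i = 2
      · subst hi; rw [h4]; exact hl
      · exact ⟨(hc.lower_le hi).trans (h3 i hi).1, (h3 i hi).2.trans (hc.upper_le hi)⟩
    · by_cases hi : i = 2
      · subst hi; rw [h4]; exact hr
      · exact h3 i hi

/-- Of three bricks through one point, any two would lie on different sides of a horizontal plane
through that point, but a plane has only two sides. Local questions thus involve at most two bricks.
-/
theorem eq_or_eq_of_mem {B₁ B₂ B₃ : Box} (h₁ : B₁ ∈ 𝓑) (h₂ : B₂ ∈ 𝓑) (h₃ : B₃ ∈ 𝓑)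
    (hne : B₁ ≠ B₂) {p : Point} (hp₁ : p ∈ Box.Icc B₁) (hp₂ : p ∈ Box.Icc B₂)
    (hp₃ : p ∈ Box.Icc B₃) : B₃ = B₁ ∨ B₃ = B₂ := by
  by_contra! hcon
  have t12 := h𝓑.touch _ h₁ _ h₂ hne ⟨p, hp₁, hp₂⟩
  have t31 := h𝓑.touch _ h₃ _ h₁ hcon.1 ⟨p, hp₃, hp₁⟩
  have t32 := h𝓑.touch _ h₃ _ h₂ hcon.2 ⟨p, hp₃, hp₂⟩
  have b1 := mem_box.1 hp₁ 2
  have b2 := mem_box.1 hp₂ 2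
  have b3 := mem_box.1 hp₃ 2
  have l1 := B₁.lower_lt_upper 2
  have l2 := B₂.lower_lt_upper 2
  have l3 := B₃.lower_lt_upper 2
  rcases t12 with t12 | t12 <;> rcases t31 with t31 | t31 <;> rcases t32 with t32 | t32 <;>
    linarith

end IsStackPartition

/-- The union of the bricks. -/
def body (𝓑 : Finset Box) : Set Point := ⋃ B ∈ 𝓑, Box.Icc B

theorem mem_body {𝓑 : Finset Box} {p : Point} : p ∈ body 𝓑 ↔ ∃ B ∈ 𝓑, p ∈ Box.Icc B := by
  simp [body]

theorem eventually_lt_apply {c : ℝ} {k : Fin 3} {p : Point} (h : c < p k) :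
    ∀ᶠ q : Point in nhds p, c < q k :=
  ((continuous_apply k).tendsto p).eventually_const_lt h

theorem eventually_apply_lt {c : ℝ} {k : Fin 3} {p : Point} (h : p k < c) :
    ∀ᶠ q : Point in nhds p, q k < c :=
  ((continuous_apply k).tendsto p).eventually_lt_const h

theorem eventually_mem_imp (𝓑 : Finset Box) (p : Point) :
    ∀ᶠ q in nhds p, ∀ B ∈ 𝓑, q ∈ Box.Icc B → p ∈ Box.Icc B := by
  rw [Filter.eventually_all_finset]
  intro B _
  by_cases h : p ∈ Box.Icc B
  · exact Filter.Eventually.of_forall fun _ _ => h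
  · have : IsClosed (Box.Icc B : Set Point) := by rw [Box.Icc_def]; exact isClosed_Icc
    filter_upwards [this.isOpen_compl.mem_nhds h] with q hq h' using absurd h' hq

/-- A property that holds near `p` holds at all points of a small cube around `p`, which moreover
meets only bricks that contain `p`. -/
theorem exists_near (𝓑 : Finset Box) {Q : Point → Prop} {p : Point} (hQ : ∀ᶠ q in nhds p, Q q) :
    ∃ ε > 0, ∀ q : Point, (∀ i, |q i - p i| < ε) →
      Q q ∧ ∀ B ∈ 𝓑, q ∈ Box.Icc B → p ∈ Box.Icc B := by
  obtain ⟨ε, hε, h⟩ := Metric.eventually_nhds_iff.1 (hQ.and (eventually_mem_imp 𝓑 p))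
  refine ⟨ε, hε, fun q hq => h ?_⟩
  rw [dist_pi_lt_iff hε]
  intro i
  rw [Real.dist_eq]
  exact hq i

/-! ### The reflex edge bordering a contact. -/

theorem exists_third_axis {j : Fin 3} (hj : j ≠ 2) :
    ∃ i : Fin 3, i ≠ 2 ∧ i ≠ j ∧ ∀ Q : Fin 3 → Prop, (∀ k, Q k) ↔ Q 2 ∧ Q j ∧ Q i := by
  fin_cases j
  · exact ⟨1, by decide, by decide, fun Q => by rw [Fin.forall_fin_succ, Fin.forall_fin_two]; tauto⟩
  · exact ⟨0, by decide, by decide, fun Q => by rw [Fin.forall_fin_succ, Fin.forall_fin_two]; tauto⟩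
  · exact absurd rfl hj

open Classical in
/-- An endpoint of the reflex edge that borders the contact of `v` and `a`. -/
noncomputable def contactEnd (v a : Box) (u : Bool) : Point := fun k =>
  if k = 2 then height v a
  else if v.lower k = a.lower k then
    if v.upper k = a.upper k then side a k u else a.upper k
  else a.lower k

/-- The reflex edge that borders the contact of the larger brick `v` and the smaller brick `a`. -/
noncomputable def contactEdge (v a : Box) : Point × Point :=
  (contactEnd v a false, contactEnd v a true)

@[simp] theorem contactEnd_two (v a : Box) (u : Bool) : contactEnd v a u 2 = height v a := by
  simp [contactEnd]

namespace FlushAt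

variable {v a : Box} {j : Fin 3} {s : Bool} (h : FlushAt v a j s)
include h

theorem contactEnd_axis (u : Bool) : contactEnd v a u j = side a j (!s) := by
  have h1 := h.flush; have h2 := h.lower_lt; have h3 := h.lt_upper
  unfold contactEnd
  rw [if_neg h.horizontal]
  cases s <;> simp at h1 h2 h3 ⊢
  · simp [h1, h3.ne']
  · simp [h2.ne]

theorem contactEnd_other (u : Bool) {i : Fin 3} (hi : i ≠ 2) (hij : i ≠ j) :
    contactEnd v a u i = side a i u := by
  simp [contactEnd, h.other i hi hij, hi]

theorem mem_openSegment {p : Point} :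
    p ∈ openSegment ℝ (contactEdge v a).1 (contactEdge v a).2 ↔
      p 2 = height v a ∧ p j = side a j (!s) ∧
        ∀ i, i ≠ 2 → i ≠ j → a.lower i < p i ∧ p i < a.upper i := by
  obtain ⟨i, hi, hij, hall⟩ := exists_third_axis h.horizontal
  have hlt := a.lower_lt_upper i
  have e2 := contactEnd_two v a
  have ej := h.contactEnd_axis
  have ei := fun u => h.contactEnd_other u hi hij
  constructor
  · rintro ⟨x, y, hx, hy, hxy, rfl⟩
    simp only [contactEdge, Pi.add_apply, Pi.smul_apply, smul_eq_mul, e2, ej]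
    refine ⟨by rw [← add_mul, hxy, one_mul], by rw [← add_mul, hxy, one_mul], ?_⟩
    intro k hk hkj
    have := (a.lower_lt_upper k)
    rw [h.contactEnd_other _ hk hkj, h.contactEnd_other _ hk hkj]
    obtain rfl : y = 1 - x := by linarith
    constructor <;> simp <;> nlinarith
  · rintro ⟨h2, hj, ho⟩
    obtain ⟨h3, h4⟩ := ho i hi hij
    have hd : 0 < a.upper i - a.lower i := by linarith
    refine ⟨(a.upper i - p i) / (a.upper i - a.lower i),
      (p i - a.lower i) / (a.upper i - a.lower i),
      div_pos (by linarith) hd, div_pos (by linarith) hd, ?_, ?_⟩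
    · field_simp; ring
    · rw [funext_iff, hall]
      simp only [contactEdge, Pi.add_apply, Pi.smul_apply, smul_eq_mul, e2, ej, ei, h2, hj,
        side_true, side_false]
      refine ⟨?_, ?_, ?_⟩ <;> field_simp <;> ring

end FlushAt

namespace IsStackPartition

variable {𝓑 : Finset Box} (h𝓑 : IsStackPartition 𝓑)
include h𝓑

/-- Near an interior point of the edge only `v` and `a` matter: `v` is a half-space on one side of
the contact plane, and `a` a quadrant on the other side. -/
theorem isReflexPoint {v a : Box} (hc : (v, a) ∈ contacts 𝓑) {j : Fin 3} {s : Bool}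
    (h : FlushAt v a j s) {i : Fin 3} (hi : i ≠ 2) (hij : i ≠ j) {p : Point}
    (hp : p ∈ openSegment ℝ (contactEdge v a).1 (contactEdge v a).2) :
    ∃ S T : ℝ, (S = 1 ∨ S = -1) ∧ (T = 1 ∨ T = -1) ∧
      ∀ᶠ q in nhds p, q ∈ body 𝓑 ↔ ¬ (0 < S * (q j - p j) ∧ 0 < T * (q 2 - p 2)) := by
  obtain ⟨hv, ha, hcon⟩ := mem_contacts.1 hc
  obtain ⟨i', hi', hij', hall⟩ := exists_third_axis h.horizontal
  obtain rfl : i' = i := by have := h.horizontal; omega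
  obtain ⟨p2, pj, po⟩ := h.mem_openSegment.1 hp
  obtain ⟨pi1, pi2⟩ := po i' hi hij
  obtain ⟨o1, o2⟩ := h.other i' hi hij
  obtain ⟨σ, hσ1, hσ2⟩ := h𝓑.height_spec hc
  have hpm : p ∈ Box.Icc v ∧ p ∈ Box.Icc a := by
    rw [h𝓑.mem_contact_iff hc]
    refine ⟨fun k hk => ?_, p2⟩
    have hle := (a.lower_lt_upper j).le
    by_cases hkj : k = j
    · subst hkj; rw [pj]; cases s <;> simpa using hle
    · exact ⟨(po k hk hkj).1.le, (po k hk hkj).2.le⟩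
  have key : ∀ᶠ q in nhds p, (q ∈ body 𝓑 ↔ q ∈ Box.Icc v ∨ q ∈ Box.Icc a) := by
    filter_upwards [eventually_mem_imp 𝓑 p] with q hq
    rw [mem_body]
    constructor
    · rintro ⟨B, hB, hqB⟩
      rcases h𝓑.eq_or_eq_of_mem hv ha hB hcon.ne hpm.1 hpm.2 (hq B hB hqB) with rfl | rfl
      · exact Or.inl hqB
      · exact Or.inr hqB
    · rintro (h | h)
      · exact ⟨v, hv, h⟩
      · exact ⟨a, ha, h⟩
  have f1 := h.flush
  have f2 := h.lower_lt
  have f3 := h.lt_upper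
  have z1 := v.lower_lt_upper 2
  have z2 := a.lower_lt_upper 2
  have z3 := a.lower_lt_upper j
  -- The missing quadrant lies horizontally beyond the free side of `a`, which is the one opposite
  -- to `s`, and vertically on the side of the contact plane away from `v`.
  refine ⟨if s then -1 else 1, if σ then 1 else -1, by cases s <;> simp, by cases σ <;> simp, ?_⟩
  cases s <;> cases σ <;> simp only [side_true, side_false, Bool.not_true, Bool.not_false] at *
  · filter_upwards [key, eventually_lt_apply pi1, eventually_apply_lt pi2,
      eventually_lt_apply (p := p) (f2.trans_eq pj.symm),
      eventually_apply_lt (p := p) (pj.trans_lt f3),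
      eventually_apply_lt (p := p) (p2.trans_lt (hσ1 ▸ z1)),
      eventually_lt_apply (p := p) (z2.trans_eq (hσ2.trans p2.symm))]
      with q hq q1 q2 q3 q4 q5 q6
    rw [hq, mem_box, mem_box, hall, hall]
    simp
    grind
  · filter_upwards [key, eventually_lt_apply pi1, eventually_apply_lt pi2,
      eventually_lt_apply (p := p) (f2.trans_eq pj.symm),
      eventually_apply_lt (p := p) (pj.trans_lt f3),
      eventually_lt_apply (p := p) (z1.trans_eq (hσ1.trans p2.symm)),
      eventually_apply_lt (p := p) (p2.trans_lt (hσ2 ▸ z2))]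
      with q hq q1 q2 q3 q4 q5 q6
    rw [hq, mem_box, mem_box, hall, hall]
    simp
    grind
  · filter_upwards [key, eventually_lt_apply pi1, eventually_apply_lt pi2,
      eventually_lt_apply (p := p) (f2.trans_eq pj.symm),
      eventually_apply_lt (p := p) (pj.trans_lt f3),
      eventually_apply_lt (p := p) (p2.trans_lt (hσ1 ▸ z1)),
      eventually_lt_apply (p := p) (z2.trans_eq (hσ2.trans p2.symm))]
      with q hq q1 q2 q3 q4 q5 q6
    rw [hq, mem_box, mem_box, hall, hall]
    simp
    grind
  · filter_upwards [key, eventually_lt_apply pi1, eventually_apply_lt pi2,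
      eventually_lt_apply (p := p) (f2.trans_eq pj.symm),
      eventually_apply_lt (p := p) (pj.trans_lt f3),
      eventually_lt_apply (p := p) (z1.trans_eq (hσ1.trans p2.symm)),
      eventually_apply_lt (p := p) (p2.trans_lt (hσ2 ▸ z2))]
      with q hq q1 q2 q3 q4 q5 q6
    rw [hq, mem_box, mem_box, hall, hall]
    simp
    grind

end IsStackPartition

theorem FlushAt.exists_mem_openSegment {v a : Box} {j : Fin 3} {s : Bool} (h : FlushAt v a j s) :
    ∃ p, p ∈ openSegment ℝ (contactEdge v a).1 (contactEdge v a).2 := by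
  refine ⟨fun k => if k = 2 then height v a else if k = j then side a j (!s) else
    (a.lower k + a.upper k) / 2, h.mem_openSegment.2 ⟨if_pos rfl, ?_, fun i hi hij => ?_⟩⟩
  · simp [h.horizontal]
  · have := a.lower_lt_upper i
    simp only [hi, hij, if_false]
    constructor <;> linarith

namespace IsStackPartition

variable {𝓑 : Finset Box} (h𝓑 : IsStackPartition 𝓑)
include h𝓑

theorem mem_of_mem_openSegment {v a : Box} (hc : (v, a) ∈ contacts 𝓑) {p : Point}
    (hp : p ∈ segment ℝ (contactEdge v a).1 (contactEdge v a).2) :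
    p ∈ Box.Icc v ∧ p ∈ Box.Icc a := by
  obtain ⟨j, s, h⟩ := (mem_contacts.1 hc).2.2.flush
  have hend : ∀ u, contactEnd v a u ∈ Box.Icc v ∧ contactEnd v a u ∈ Box.Icc a := by
    intro u
    rw [h𝓑.mem_contact_iff hc]
    refine ⟨fun k hk => ?_, contactEnd_two v a u⟩
    have hle := (a.lower_lt_upper k).le
    by_cases hkj : k = j
    · subst hkj; rw [h.contactEnd_axis]; cases s <;> simpa using hle
    · rw [h.contactEnd_other u hk hkj]; cases u <;> simpa using hle
  have conv : ∀ B : Box, Convex ℝ (Box.Icc B : Set Point) := fun B => by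
    rw [Box.Icc_def]; exact convex_Icc _ _
  exact ⟨(conv v).segment_subset (hend false).1 (hend true).1 hp,
    (conv a).segment_subset (hend false).2 (hend true).2 hp⟩

/-- Continuing along the axis beyond the endpoint leaves both `v` and `a`, the only bricks nearby,
whereas the line through a reflex point stays locally in the solid. -/
theorem not_isReflexPoint_contactEnd {v a : Box} (hc : (v, a) ∈ contacts 𝓑) {j : Fin 3} {s : Bool}
    (h : FlushAt v a j s) {i : Fin 3} (hi : i ≠ 2) (hij : i ≠ j) (u : Bool) :
    ¬ IsReflexPoint (body 𝓑) i (contactEnd v a u) := by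
  rintro ⟨k, l, hk, hl, hkl, S, T, -, -, hev⟩
  obtain ⟨hv, ha, hcon⟩ := mem_contacts.1 hc
  have hp : contactEnd v a u ∈ Box.Icc v ∧ contactEnd v a u ∈ Box.Icc a := by
    refine h𝓑.mem_of_mem_openSegment hc ?_
    cases u
    · exact left_mem_segment _ _ _
    · exact right_mem_segment _ _ _
  obtain ⟨ε, hε, hnear⟩ := exists_near 𝓑 hev
  set p := contactEnd v a u with hpdef
  have hpi : p i = side a i u := h.contactEnd_other u hi hij
  set q : Point := Function.update p i (p i + if u then ε / 2 else -(ε / 2)) with hq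
  obtain ⟨h1, h2⟩ := hnear q (by
    intro m
    rw [hq]
    by_cases hm : m = i
    · subst hm
      rw [Function.update_self, add_sub_cancel_left]
      have habs := abs_of_pos (half_pos hε)
      cases u <;> simp [habs] <;> linarith
    · simp [hm, hε])
  have hqk : q k = p k := by rw [hq, Function.update_of_ne hk]
  have hqP := h1.2 (by rw [hqk]; simp)
  obtain ⟨B, hB, hqB⟩ := mem_body.1 hqP
  have hb := mem_box.1 hqB i
  rw [hq, Function.update_self, hpi] at hb
  obtain ⟨o1, o2⟩ := h.other i hi hij
  rcases h𝓑.eq_or_eq_of_mem hv ha hB hcon.ne hp.1 hp.2 (h2 B hB hqB) with rfl | rfl <;>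
    cases u <;> simp at hb <;> linarith

theorem contactEdge_mem_reflexEdges {v a : Box} (hc : (v, a) ∈ contacts 𝓑) :
    contactEdge v a ∈ reflexEdges (body 𝓑) := by
  obtain ⟨j, s, h⟩ := (mem_contacts.1 hc).2.2.flush
  obtain ⟨i, hi, hij, hall⟩ := exists_third_axis h.horizontal
  refine ⟨i, ?_, ?_, ?_, h𝓑.not_isReflexPoint_contactEnd hc h hi hij _,
    h𝓑.not_isReflexPoint_contactEnd hc h hi hij _⟩
  · simp only [contactEdge, h.contactEnd_other _ hi hij]
    exact a.lower_lt_upper i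
  · rw [hall]
    simp [contactEdge, h.contactEnd_axis]
  · intro p hp
    obtain ⟨S, T, hS, hT, hev⟩ := h𝓑.isReflexPoint hc h hi hij hp
    exact ⟨j, 2, hij.symm, hi.symm, h.horizontal, S, T, hS, hT, hev⟩

/-- A point of the edge lies in both bricks and in no third one, so it determines the pair;
comparing sizes determines the order. -/
theorem contactEdge_injOn :
    Set.InjOn (fun e : Box × Box => contactEdge e.1 e.2) (contacts 𝓑) := by
  rintro ⟨v, a⟩ hc ⟨v', a'⟩ hc' heq
  rw [Finset.mem_coe] at hc hc'
  obtain ⟨hv, ha, hcon⟩ := mem_contacts.1 hc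
  obtain ⟨hv', ha', hcon'⟩ := mem_contacts.1 hc'
  obtain ⟨j, s, h⟩ := hcon.flush
  obtain ⟨p, hp⟩ := h.exists_mem_openSegment
  have hm := h𝓑.mem_of_mem_openSegment hc (openSegment_subset_segment _ _ _ hp)
  simp only at heq
  rw [heq] at hp
  have hm' := h𝓑.mem_of_mem_openSegment hc' (openSegment_subset_segment _ _ _ hp)
  rcases h𝓑.eq_or_eq_of_mem hv ha hv' hcon.ne hm.1 hm.2 hm'.1 with rfl | rfl <;>
    rcases h𝓑.eq_or_eq_of_mem hv ha ha' hcon.ne hm.1 hm.2 hm'.2 with rfl | rfl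
  · exact absurd rfl hcon'.ne
  · rfl
  · exact absurd hcon' hcon.not_symm
  · exact absurd rfl hcon'.ne

/-- Only this inequality is needed: further reflex edges would merely weaken the required bound. -/
theorem card_contacts_le (hfin : (reflexEdges (body 𝓑)).Finite) :
    (contacts 𝓑).card ≤ (reflexEdges (body 𝓑)).ncard := by
  rw [← Set.ncard_coe_finset, ← h𝓑.contactEdge_injOn.ncard_image]
  refine Set.ncard_le_ncard ?_ hfin
  rintro _ ⟨⟨v, a⟩, hc, rfl⟩
  exact h𝓑.contactEdge_mem_reflexEdges hc

/-- An interior point in just one brick can be moved both ways along each axis inside it. For a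
point of a contact, a slight vertical shift off the larger brick leaves only the smaller one, which
therefore must extend beyond the point in every horizontal direction. -/
theorem mem_interior_iff {p : Point} :
    p ∈ interior (body 𝓑) ↔
      (∃ B ∈ 𝓑, ∀ i, B.lower i < p i ∧ p i < B.upper i) ∨
      ∃ e ∈ contacts 𝓑, (∀ i, i ≠ 2 → e.2.lower i < p i ∧ p i < e.2.upper i) ∧
        p 2 = height e.1 e.2 := by
  rw [mem_interior_iff_mem_nhds]
  constructor
  · intro hp
    obtain ⟨ε, hε, hnear⟩ := exists_near 𝓑 (Q := fun q => q ∈ body 𝓑) hp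
    obtain ⟨B, hB, hpB⟩ := mem_body.1 (mem_of_mem_nhds hp)
    have hbox := mem_box.1 hpB
    have pos : |ε / 2| < ε := by rw [abs_of_pos] <;> linarith
    have neg : |-(ε / 2)| < ε := by rw [abs_neg]; exact pos
    by_cases huniq : ∀ B' ∈ 𝓑, p ∈ Box.Icc B' → B' = B
    · refine Or.inl ⟨B, hB, fun i => ?_⟩
      have key : ∀ d : ℝ, |d| < ε → B.lower i ≤ p i + d ∧ p i + d ≤ B.upper i := by
        intro d hd
        obtain ⟨h1, h2⟩ := hnear (Function.update p i (p i + d)) (by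
          intro m
          by_cases hm : m = i
          · subst hm; simpa using hd
          · simp [hm, hε])
        obtain ⟨B', hB', hqB'⟩ := mem_body.1 h1
        obtain rfl := huniq B' hB' (h2 B' hB' hqB')
        simpa using mem_box.1 hqB' i
      have k1 := key _ pos
      have k2 := key _ neg
      constructor <;> linarith
    · push Not at huniq
      obtain ⟨B', hB', hpB', hne⟩ := huniq
      obtain ⟨v, a, hc, hpv, hpa⟩ : ∃ v a, (v, a) ∈ contacts 𝓑 ∧ p ∈ Box.Icc v ∧ p ∈ Box.Icc a := by
        rcases h𝓑.contact_or hB hB' hne.symm ⟨p, hpB, hpB'⟩ with h | h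
        · exact ⟨B, B', h, hpB, hpB'⟩
        · exact ⟨B', B, h, hpB', hpB⟩
      obtain ⟨hv, ha, hcon⟩ := mem_contacts.1 hc
      have h2 := ((h𝓑.mem_contact_iff hc).1 ⟨hpv, hpa⟩).2
      refine Or.inr ⟨(v, a), hc, fun i hi => ?_, h2⟩
      obtain ⟨σ, hσ, -⟩ := h𝓑.height_spec hc
      have key : ∀ d : ℝ, |d| < ε → a.lower i ≤ p i + d ∧ p i + d ≤ a.upper i := by
        intro d hd
        -- The vertical shift leads away from `v`, so that the shifted point can only belong to `a`.
        set z : ℝ := if σ then ε / 2 else -(ε / 2) with hz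
        have hzε : |z| < ε := by cases σ <;> simp only [hz, if_true] <;> assumption
        obtain ⟨h1, h3⟩ := hnear (Function.update (Function.update p 2 (p 2 + z)) i (p i + d)) (by
          intro m
          by_cases hm : m = i
          · subst hm; simpa using hd
          · by_cases hm2 : m = 2
            · subst hm2; simpa [hm] using hzε
            · simp [hm, hm2, hε])
        obtain ⟨C, hC, hqC⟩ := mem_body.1 h1
        rcases h𝓑.eq_or_eq_of_mem hv ha hC hcon.ne hpv hpa (h3 C hC hqC) with rfl | rfl
        · have := mem_box.1 hqC 2
          rw [Function.update_of_ne hi.symm, Function.update_self] at this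
          exfalso
          cases σ <;> simp at hσ hz <;> linarith
        · simpa using mem_box.1 hqC i
      have k1 := key _ pos
      have k2 := key _ neg
      constructor <;> linarith
  · rintro (⟨B, hB, h⟩ | ⟨⟨v, a⟩, hc, h1, h2⟩)
    · have : ∀ᶠ q in nhds p, ∀ i, B.lower i < q i ∧ q i < B.upper i :=
        Filter.eventually_all.2 fun i =>
          (eventually_lt_apply (h i).1).and (eventually_apply_lt (h i).2)
      filter_upwards [this] with q hq
      exact mem_body.2 ⟨B, hB, mem_box.2 fun i => ⟨(hq i).1.le, (hq i).2.le⟩⟩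
    · obtain ⟨hv, ha, hcon⟩ := mem_contacts.1 hc
      obtain ⟨σ, hσ1, hσ2⟩ := h𝓑.height_spec hc
      simp only at h1 h2
      have ev : ∀ᶠ q in nhds p, ∀ i, i ≠ 2 → a.lower i < q i ∧ q i < a.upper i :=
        Filter.eventually_all.2 fun i => by
          by_cases hi : i = 2
          · simp [hi]
          · filter_upwards [(eventually_lt_apply (h1 i hi).1).and (eventually_apply_lt (h1 i hi).2)]
              with q hq _ using hq
      have inv : ∀ q : Point, (∀ i, i ≠ 2 → a.lower i < q i ∧ q i < a.upper i) →
          v.lower 2 ≤ q 2 → q 2 ≤ v.upper 2 → q ∈ body 𝓑 := by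
        intro q hq hz1 hz2
        refine mem_body.2 ⟨v, hv, mem_box.2 fun i => ?_⟩
        by_cases hi : i = 2
        · subst hi; exact ⟨hz1, hz2⟩
        · exact ⟨(hcon.lower_le hi).trans (hq i hi).1.le, (hq i hi).2.le.trans (hcon.upper_le hi)⟩
      have ina : ∀ q : Point, (∀ i, i ≠ 2 → a.lower i < q i ∧ q i < a.upper i) →
          a.lower 2 ≤ q 2 → q 2 ≤ a.upper 2 → q ∈ body 𝓑 := by
        intro q hq hz1 hz2
        refine mem_body.2 ⟨a, ha, mem_box.2 fun i => ?_⟩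
        by_cases hi : i = 2
        · subst hi; exact ⟨hz1, hz2⟩
        · exact ⟨(hq i hi).1.le, (hq i hi).2.le⟩
      have z1 := v.lower_lt_upper 2
      have z2 := a.lower_lt_upper 2
      cases σ <;> simp at hσ1 hσ2
      · filter_upwards [ev, eventually_apply_lt (p := p) (h2.trans_lt (hσ1 ▸ z1)),
          eventually_lt_apply (p := p) ((hσ2 ▸ z2).trans_eq h2.symm)] with q hq q1 q2
        rcases le_total (q 2) (height v a) with h | h
        · exact ina q hq q2.le (hσ2.symm ▸ h)
        · exact inv q hq (hσ1.symm ▸ h) q1.le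
      · filter_upwards [ev, eventually_lt_apply (p := p) ((hσ1 ▸ z1).trans_eq h2.symm),
          eventually_apply_lt (p := p) (h2.trans_lt (hσ2 ▸ z2))] with q hq q1 q2
        rcases le_total (q 2) (height v a) with h | h
        · exact inv q hq q1.le (hσ1.symm ▸ h)
        · exact ina q hq (hσ2.symm ▸ h) q2.le

end IsStackPartition

/-! ### Euler characteristics on grids. -/

section LineCells

theorem mem_lineCells {X : Finset ℝ} {c : ℝ × ℝ} :
    c ∈ lineCells X ↔ c.1 ∈ X ∧ c.2 ∈ X ∧ c.1 ≤ c.2 ∧ ∀ x ∈ X, ¬ (c.1 < x ∧ x < c.2) := by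
  simp [lineCells, and_assoc]

/-- The midpoint of a cell of the line. -/
noncomputable def cellMid (c : ℝ × ℝ) : ℝ := (c.1 + c.2) / 2

open Classical in
/-- The sign of a cell of the line in the Euler characteristic. -/
noncomputable def cellSign (c : ℝ × ℝ) : ℤ := if c.1 ≠ c.2 then -1 else 1

theorem cellMid_mem_openSegment (c : ℝ × ℝ) : cellMid c ∈ openSegment ℝ c.1 c.2 :=
  ⟨1 / 2, 1 / 2, by norm_num, by norm_num, by norm_num, by simp [cellMid]; ring⟩

theorem eq_or_between {c : ℝ × ℝ} (h : c.1 ≤ c.2) {y : ℝ} (hy : y ∈ openSegment ℝ c.1 c.2) :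
    (c.1 = c.2 ∧ y = c.1) ∨ (c.1 < y ∧ y < c.2) := by
  rcases h.eq_or_lt with h | h
  · rw [← h, openSegment_same] at hy
    exact Or.inl ⟨h, hy⟩
  · rw [openSegment_eq_Ioo h] at hy
    exact Or.inr hy

theorem cell_le_iff {X : Finset ℝ} {c : ℝ × ℝ} (hc : c ∈ lineCells X) {x : ℝ} (hx : x ∈ X) {y : ℝ}
    (hy : y ∈ openSegment ℝ c.1 c.2) :
    (x ≤ y ↔ x ≤ c.1) ∧ (y ≤ x ↔ c.2 ≤ x) := by
  obtain ⟨-, -, hle, hno⟩ := mem_lineCells.1 hc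
  have := hno x hx
  have := eq_or_between hle hy
  grind

theorem cell_const {X : Finset ℝ} {c : ℝ × ℝ} (hc : c ∈ lineCells X) {x : ℝ} (hx : x ∈ X) {y : ℝ}
    (hy : y ∈ openSegment ℝ c.1 c.2) :
    (x ≤ y ↔ x ≤ cellMid c) ∧ (y ≤ x ↔ cellMid c ≤ x) ∧
      (x < y ↔ x < cellMid c) ∧ (y < x ↔ cellMid c < x) := by
  have h1 := cell_le_iff hc hx hy
  have h2 := cell_le_iff hc hx (cellMid_mem_openSegment c)
  refine ⟨h1.1.trans h2.1.symm, h1.2.trans h2.2.symm, ?_, ?_⟩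
  · rw [← not_le, ← not_le, h1.2, h2.2]
  · rw [← not_le, ← not_le, h1.1, h2.1]

-- A grid with `n` points has `n` point cells and `n - 1` gaps; a gap is identified by its right
-- endpoint, which can be any point but the least.
open Classical in
theorem sum_cellSign {Y : Finset ℝ} (hY : Y.Nonempty) : ∑ c ∈ lineCells Y, cellSign c = 1 := by
  have h1 : ((lineCells Y).filter fun c => ¬ c.1 ≠ c.2).card = Y.card := by
    refine Finset.card_nbij' (fun c => c.1) (fun x => (x, x)) ?_ ?_ ?_ ?_
    · intro c hc
      exact (mem_lineCells.1 (Finset.mem_filter.1 hc).1).1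
    · intro x hx
      refine Finset.mem_filter.2 ⟨mem_lineCells.2 ⟨hx, hx, le_rfl, fun z _ h => ?_⟩, by simp⟩
      exact lt_asymm h.1 h.2
    · rintro ⟨x, y⟩ hc
      have := (Finset.mem_filter.1 hc).2
      simp only [ne_eq, not_not] at this
      simp [this]
    · intro x _; rfl
  have h2 : ((lineCells Y).filter fun c => c.1 ≠ c.2).card = (Y.erase (Y.min' hY)).card := by
    refine Finset.card_bij (fun c _ => c.2) ?_ ?_ ?_
    · intro c hc
      obtain ⟨hc, hne⟩ := Finset.mem_filter.1 hc
      obtain ⟨m1, m2, hle, -⟩ := mem_lineCells.1 hc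
      refine Finset.mem_erase.2 ⟨?_, m2⟩
      exact ((Y.min'_le _ m1).trans_lt (lt_of_le_of_ne hle hne)).ne'
    · rintro ⟨x, y⟩ hc ⟨x', y'⟩ hc' heq
      obtain ⟨hc, hne⟩ := Finset.mem_filter.1 hc
      obtain ⟨hc', hne'⟩ := Finset.mem_filter.1 hc'
      obtain ⟨m1, m2, hle, hno⟩ := mem_lineCells.1 hc
      obtain ⟨m1', m2', hle', hno'⟩ := mem_lineCells.1 hc'
      simp only at *
      subst heq
      have := hno x' m1'
      have := hno' x m1
      have a1 := lt_of_le_of_ne hle hne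
      have a2 := lt_of_le_of_ne hle' hne'
      have : x = x' := by
        by_contra h
        rcases lt_or_gt_of_ne h with h | h <;> tauto
      rw [this]
    · intro y hy
      obtain ⟨hne, hy⟩ := Finset.mem_erase.1 hy
      have hlt : Y.min' hY < y := lt_of_le_of_ne (Y.min'_le _ hy) hne.symm
      have hZ : (Y.filter (· < y)).Nonempty := ⟨_, Finset.mem_filter.2 ⟨Y.min'_mem hY, hlt⟩⟩
      obtain ⟨m1, m2⟩ := Finset.mem_filter.1 (Finset.max'_mem _ hZ)
      refine ⟨((Y.filter (· < y)).max' hZ, y), Finset.mem_filter.2 ⟨mem_lineCells.2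
        ⟨m1, hy, m2.le, fun z hz h => ?_⟩, m2.ne⟩, rfl⟩
      exact absurd (Finset.le_max' _ z (Finset.mem_filter.2 ⟨hz, h.2⟩)) (not_le.2 h.1)
  unfold cellSign
  rw [Finset.sum_ite, Finset.sum_const, Finset.sum_const, h1, h2,
    Finset.card_erase_of_mem (Y.min'_mem hY)]
  have := Finset.card_pos.2 hY
  simp
  omega

/-- The combinatorial Euler characteristic of an integer-valued function on the line. -/
noncomputable def lineEuler (X : Finset ℝ) (f : ℝ → ℤ) : ℤ :=
  ∑ c ∈ lineCells X, cellSign c * f (cellMid c)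

open Classical in
/-- The indicator function of a set, with integer values. -/
noncomputable def ind {α : Type*} (s : Set α) (x : α) : ℤ := if x ∈ s then 1 else 0

-- Since both ends are grid points, the cells in the interval are the cells of the grid points lying
-- in it.
open Classical in
theorem lineEuler_Icc {X : Finset ℝ} {a b : ℝ} (ha : a ∈ X) (hb : b ∈ X) (hab : a ≤ b) :
    lineEuler X (ind (Set.Icc a b)) = 1 := by
  have hsub : (lineCells X).filter (fun c => cellMid c ∈ Set.Icc a b) =
      lineCells (X.filter fun x => a ≤ x ∧ x ≤ b) := by
    ext c
    rw [Finset.mem_filter, mem_lineCells]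
    constructor
    · rintro ⟨⟨h1, h2, h3, h4⟩, h5, h6⟩
      have hc := mem_lineCells.2 ⟨h1, h2, h3, h4⟩
      rw [(cell_le_iff hc ha (cellMid_mem_openSegment c)).1] at h5
      rw [(cell_le_iff hc hb (cellMid_mem_openSegment c)).2] at h6
      rw [mem_lineCells]
      simp only [Finset.mem_filter]
      exact ⟨⟨h1, h5, h3.trans h6⟩, ⟨h2, h5.trans h3, h6⟩, h3, fun x hx => h4 x hx.1⟩
    · rw [mem_lineCells]
      simp only [Finset.mem_filter]
      rintro ⟨h1, h2, h3, h4⟩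
      refine ⟨⟨h1.1, h2.1, h3, fun x hx h => h4 x ⟨hx, ?_, ?_⟩ h⟩, ?_, ?_⟩
      · exact h1.2.1.trans h.1.le
      · exact h.2.le.trans h2.2.2
      · unfold cellMid; linarith [h1.2.1, h2.2.1]
      · unfold cellMid; linarith [h1.2.2, h2.2.2]
  unfold lineEuler ind
  simp only [mul_ite, mul_one, mul_zero]
  rw [← Finset.sum_filter, hsub]
  exact sum_cellSign ⟨a, by simp [ha, hab]⟩

theorem lineEuler_Ioo {X : Finset ℝ} {a b : ℝ} (ha : a ∈ X) (hb : b ∈ X) (hab : a < b) :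
    lineEuler X (ind (Set.Ioo a b)) = -1 := by
  have h : ∀ x, ind (Set.Ioo a b) x =
      ind (Set.Icc a b) x - ind (Set.Icc a a) x - ind (Set.Icc b b) x := by
    intro x
    simp only [ind, Set.mem_Icc, Set.mem_Ioo]
    split_ifs <;> grind
  have h1 := lineEuler_Icc ha hb hab.le
  have h2 := lineEuler_Icc ha ha le_rfl
  have h3 := lineEuler_Icc hb hb le_rfl
  unfold lineEuler at *
  simp only [h, mul_sub, Finset.sum_sub_distrib]
  rw [h1, h2, h3]; norm_num

end LineCells

/-- The combinatorial Euler characteristic of an integer-valued function on space. -/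
noncomputable def spaceEuler (X : Fin 3 → Finset ℝ) (f : Point → ℤ) : ℤ :=
  ∑ c ∈ Fintype.piFinset fun i => lineCells (X i), (-1) ^ cellDim c * f fun i => cellMid (c i)

theorem spaceEuler_sub (X : Fin 3 → Finset ℝ) (f g : Point → ℤ) :
    spaceEuler X (fun p => f p - g p) = spaceEuler X f - spaceEuler X g := by
  simp [spaceEuler, mul_sub]

theorem spaceEuler_add (X : Fin 3 → Finset ℝ) (f g : Point → ℤ) :
    spaceEuler X (fun p => f p + g p) = spaceEuler X f + spaceEuler X g := by
  simp [spaceEuler, mul_add, Finset.sum_add_distrib]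

theorem spaceEuler_sum (X : Fin 3 → Finset ℝ) {ι : Type*} (s : Finset ι) (f : ι → Point → ℤ) :
    spaceEuler X (fun p => ∑ i ∈ s, f i p) = ∑ i ∈ s, spaceEuler X (f i) := by
  simp only [spaceEuler, Finset.mul_sum]
  exact Finset.sum_comm

/-- Both the sign of a cell and the indicator of a product set factor over the coordinates. -/
theorem spaceEuler_pi (X : Fin 3 → Finset ℝ) (s : Fin 3 → Set ℝ) :
    spaceEuler X (ind (Set.univ.pi s)) = ∏ i, lineEuler (X i) (ind (s i)) := by
  classical
  unfold spaceEuler lineEuler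
  rw [Finset.prod_univ_sum]
  refine Finset.sum_congr rfl fun c _ => ?_
  rw [Finset.prod_mul_distrib]
  congr 1
  · unfold cellSign cellDim
    rw [Finset.prod_ite]; simp
  · unfold ind
    by_cases h : ∀ i, cellMid (c i) ∈ s i
    · simp [h]
    · have h' := h
      push Not at h'
      obtain ⟨i, hi⟩ := h'
      rw [Finset.prod_eq_zero (Finset.mem_univ i) (by simp [hi]), if_neg]
      exact fun hm => h fun i => hm i (Set.mem_univ i)

/-- Membership in a grid box depends on the `i`-th coordinate only through comparisons with the
values in `X i`, and these are constant near any `t` outside `X i`. This forces the coordinates of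
the bricks into every grid, whatever boxes define it. -/
theorem IsGridFor.exists_invariant {P : Set Point} {X : Fin 3 → Finset ℝ} (hX : IsGridFor P X)
    {i : Fin 3} {t : ℝ} (ht : t ∉ X i) :
    ∃ ε > 0, ∀ q : Point, |q i - t| < ε → (q ∈ P ↔ Function.update q i t ∈ P) := by
  obtain ⟨𝓓, hcoord, rfl⟩ := hX
  have hev : ∀ᶠ y in nhds t, ∀ x ∈ X i, (x ≤ y ↔ x ≤ t) ∧ (y ≤ x ↔ t ≤ x) := by
    rw [Filter.eventually_all_finset]
    intro x hx
    have hne : x ≠ t := fun h => ht (h ▸ hx)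
    rcases lt_or_gt_of_ne hne with h | h
    · filter_upwards [lt_mem_nhds h] with y hy
      simp [hy.le, h.le, not_le.2 hy, not_le.2 h]
    · filter_upwards [gt_mem_nhds h] with y hy
      simp [hy.le, h.le, not_le.2 hy, not_le.2 h]
  obtain ⟨ε, hε, hball⟩ := Metric.eventually_nhds_iff.1 hev
  refine ⟨ε, hε, fun q hq => ?_⟩
  have hx := hball (y := q i) (by rwa [Real.dist_eq])
  simp only [Set.mem_iUnion, exists_prop]
  refine exists_congr fun B => and_congr_right fun hB => ?_
  rw [mem_box, mem_box]
  refine forall_congr' fun k => ?_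
  by_cases hk : k = i
  · subst hk
    rw [Function.update_self, (hx _ (hcoord B hB k).1).1, (hx _ (hcoord B hB k).2).2]
  · rw [Function.update_of_ne hk]

/-! ### Counting bricks and contacts by the boundary surface. -/

/-- The contact rectangle as a product of intervals. -/
def contactRect (e : Box × Box) : Set Point := Set.univ.pi fun i =>
  if i = 2 then Set.Icc (height e.1 e.2) (height e.1 e.2) else Set.Icc (e.2.lower i) (e.2.upper i)

/-- The relative interior of the contact rectangle as a product of intervals. -/
def contactInterior (e : Box × Box) : Set Point := Set.univ.pi fun i =>
  if i = 2 then Set.Icc (height e.1 e.2) (height e.1 e.2) else Set.Ioo (e.2.lower i) (e.2.upper i)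

theorem mem_contactInterior {e : Box × Box} {p : Point} :
    p ∈ contactInterior e ↔
      (∀ i, i ≠ 2 → e.2.lower i < p i ∧ p i < e.2.upper i) ∧ p 2 = height e.1 e.2 := by
  rw [contactInterior, Set.mem_univ_pi]
  constructor
  · intro h
    refine ⟨fun i hi => by simpa [hi] using h i, ?_⟩
    have := h 2
    rw [if_pos rfl] at this
    exact le_antisymm this.2 this.1
  · rintro ⟨h1, h2⟩ i
    by_cases hi : i = 2
    · subst hi; simp [h2]
    · simpa [hi] using h1 i hi

theorem contactInterior_subset (e : Box × Box) : contactInterior e ⊆ contactRect e := by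
  refine Set.pi_mono fun i _ => ?_
  split_ifs
  · exact subset_rfl
  · exact Set.Ioo_subset_Icc_self

theorem isClosed_body (𝓑 : Finset Box) : IsClosed (body 𝓑) := by
  refine Set.Finite.isClosed_biUnion 𝓑.finite_toSet fun B _ => ?_
  rw [Box.Icc_def]; exact isClosed_Icc

theorem ind_frontier (𝓑 : Finset Box) (p : Point) :
    ind (frontier (body 𝓑)) p = ind (body 𝓑) p - ind (interior (body 𝓑)) p := by
  have hsub : p ∈ interior (body 𝓑) → p ∈ body 𝓑 := fun h => interior_subset h
  unfold ind
  rw [frontier, (isClosed_body 𝓑).closure_eq]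
  by_cases h1 : p ∈ body 𝓑 <;> by_cases h2 : p ∈ interior (body 𝓑) <;> simp_all

namespace IsStackPartition

variable {𝓑 : Finset Box} (h𝓑 : IsStackPartition 𝓑) {X : Fin 3 → Finset ℝ}
  (hX : IsGridFor (body 𝓑) X)

-- Pushing `p` outwards through the side leaves the solid, which local invariance forbids when the
-- side is not a grid value.
include hX in
theorem side_mem_grid_of_unique {B : Box} {p : Point} (hp : p ∈ Box.Icc B)
    (hB : B ∈ 𝓑) (huniq : ∀ B' ∈ 𝓑, p ∈ Box.Icc B' → B' = B) {i : Fin 3} {s : Bool}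
    (hpi : p i = side B i s) : side B i s ∈ X i := by
  by_contra ht
  obtain ⟨ε₁, hε₁, h₁⟩ := hX.exists_invariant ht
  obtain ⟨ε₂, hε₂, h₂⟩ := exists_near 𝓑 (p := p) (Q := fun _ => True) (by simp)
  set δ := min ε₁ ε₂ / 2 with hδ
  have hδ0 : 0 < δ := by positivity
  have hδ1 : δ < ε₁ := by have := min_le_left ε₁ ε₂; have := lt_min hε₁ hε₂; linarith
  have hδ2 : δ < ε₂ := by have := min_le_right ε₁ ε₂; have := lt_min hε₁ hε₂; linarith
  set d := if s then δ else -δ with hd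
  have habs : |d| = δ := by cases s <;> simp [hd, abs_of_pos hδ0]
  have hq : Function.update p i (p i + d) ∈ body 𝓑 := by
    rw [h₁ _ (by simpa [hpi, habs] using hδ1), Function.update_idem, ← hpi,
      Function.update_eq_self]
    exact mem_body.2 ⟨B, hB, hp⟩
  obtain ⟨B', hB', hqB'⟩ := mem_body.1 hq
  obtain rfl := huniq B' hB' ((h₂ _ fun m => by
    by_cases hm : m = i
    · subst hm; simpa [habs] using hδ2
    · simp [hm, hε₂]).2 B' hB' hqB')
  have := mem_box.1 hqB' i
  rw [Function.update_self, hpi] at this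
  cases s <;> simp at this hd <;> linarith

include h𝓑 hX in
theorem height_mem_grid {v a : Box} (hc : (v, a) ∈ contacts 𝓑) : height v a ∈ X 2 := by
  by_contra ht
  obtain ⟨j, s, h⟩ := (mem_contacts.1 hc).2.2.flush
  obtain ⟨i, hi, hij, -⟩ := exists_third_axis h.horizontal
  obtain ⟨p, hp⟩ := h.exists_mem_openSegment
  obtain ⟨S, T, hS, hT, hev⟩ := h𝓑.isReflexPoint hc h hi hij hp
  have hp2 := (h.mem_openSegment.1 hp).1
  obtain ⟨ε₁, hε₁, h₁⟩ := hX.exists_invariant ht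
  obtain ⟨ε₂, hε₂, h₂⟩ := exists_near 𝓑 hev
  set δ := min ε₁ ε₂ / 2 with hδ
  have hδ0 : 0 < δ := by positivity
  have hδ1 : δ < ε₁ := by have := min_le_left ε₁ ε₂; have := lt_min hε₁ hε₂; linarith
  have hδ2 : δ < ε₂ := by have := min_le_right ε₁ ε₂; have := lt_min hε₁ hε₂; linarith
  have hSabs : |S * δ| = δ := by rcases hS with rfl | rfl <;> simp [abs_of_pos hδ0]
  have hTabs : |T * δ| = δ := by rcases hT with rfl | rfl <;> simp [abs_of_pos hδ0]
  have hSS : 0 < S * (S * δ) := by rcases hS with rfl | rfl <;> simpa using hδ0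
  have hTT : 0 < T * (T * δ) := by rcases hT with rfl | rfl <;> simpa using hδ0
  -- Both points leave `p` horizontally towards the missing quadrant. Only `q` is also moved
  -- vertically into it, so `q'` is in the solid and `q` is not, contrary to vertical invariance.
  set q' : Point := Function.update p j (p j + S * δ) with hq'
  have near' : ∀ m, |q' m - p m| < ε₂ := fun m => by
    by_cases hm : m = j
    · subst hm; simpa [hq', hSabs] using hδ2
    · simp [hq', hm, hε₂]
  have hq'2 : q' 2 = p 2 := Function.update_of_ne h.horizontal.symm _ _
  set q : Point := Function.update q' 2 (p 2 + T * δ) with hq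
  have near : ∀ m, |q m - p m| < ε₂ := fun m => by
    by_cases hm : m = 2
    · subst hm; simpa [hq, hTabs] using hδ2
    · simpa [hq, hm] using near' m
  have e1 := (h₂ q near).1
  have e2 := (h₂ q' near').1
  have e3 := h₁ q (by simpa [hq, hp2, hTabs] using hδ1)
  have hback : Function.update q 2 (height v a) = q' := by
    rw [hq, Function.update_idem, ← hp2, ← hq'2, Function.update_eq_self]
  rw [hback] at e3
  have hin : q' ∈ body 𝓑 := e2.2 (by rw [hq'2]; simp)
  refine e1.1 (e3.2 hin) ⟨?_, ?_⟩
  · simpa [hq, h.horizontal, hq'] using hSS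
  · simpa [hq] using hTT

include h𝓑 hX in
theorem side_mem_grid {B : Box} (hB : B ∈ 𝓑) (i : Fin 3) (s : Bool) : side B i s ∈ X i := by
  set p : Point := Function.update (fun k => (B.lower k + B.upper k) / 2) i (side B i s) with hp
  have hpi : p i = side B i s := Function.update_self _ _ _
  have hpB : p ∈ Box.Icc B := mem_box.2 fun k => by
    have := B.lower_lt_upper k
    by_cases hk : k = i
    · subst hk; rw [hpi]; cases s <;> simp [this.le]
    · simp only [hp, Function.update_of_ne hk]
      constructor <;> linarith
  by_cases huniq : ∀ B' ∈ 𝓑, p ∈ Box.Icc B' → B' = B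
  · exact side_mem_grid_of_unique hX hpB hB huniq hpi
  · push Not at huniq
    obtain ⟨B', hB', hpB', hne⟩ := huniq
    -- For a vertical side, `p` is at half the height of `B`, where no other brick can touch it.
    have hi : i = 2 := by
      by_contra hi
      have hp2 : p 2 = (B.lower 2 + B.upper 2) / 2 := by
        simp only [hp, Function.update_of_ne (Ne.symm hi)]
      have h1 := B.lower_lt_upper 2
      have h2 := mem_box.1 hpB' 2
      rcases h𝓑.touch B hB B' hB' hne.symm ⟨p, hpB, hpB'⟩ with h | h <;> linarith
    subst hi
    rw [← hpi]
    rcases h𝓑.contact_or hB hB' hne.symm ⟨p, hpB, hpB'⟩ with h | h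
    · rw [((h𝓑.mem_contact_iff h).1 ⟨hpB, hpB'⟩).2]
      exact h𝓑.height_mem_grid hX h
    · rw [((h𝓑.mem_contact_iff h).1 ⟨hpB', hpB⟩).2]
      exact h𝓑.height_mem_grid hX h

include h𝓑

theorem not_strict_of_contact {v a : Box} (hc : (v, a) ∈ contacts 𝓑) {p : Point}
    (hp : p 2 = height v a) {B : Box} (hB : B = v ∨ B = a) :
    ¬ (B.lower 2 < p 2 ∧ p 2 < B.upper 2) := by
  obtain ⟨σ, h1, h2⟩ := h𝓑.height_spec hc
  rintro ⟨h3, h4⟩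
  rcases hB with rfl | rfl <;> cases σ <;> simp at h1 h2 <;> linarith

theorem mem_contactRect {e : Box × Box} (he : e ∈ contacts 𝓑) {p : Point} :
    p ∈ contactRect e ↔ p ∈ Box.Icc e.1 ∧ p ∈ Box.Icc e.2 := by
  rw [h𝓑.mem_contact_iff he, contactRect, Set.mem_univ_pi]
  constructor
  · intro h
    refine ⟨fun i hi => by simpa [hi] using h i, ?_⟩
    have := h 2
    rw [if_pos rfl] at this
    exact le_antisymm this.2 this.1
  · rintro ⟨h1, h2⟩ i
    by_cases hi : i = 2
    · subst hi; simp [h2]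
    · simpa [hi] using h1 i hi

theorem contact_unique {e e' : Box × Box} (he : e ∈ contacts 𝓑) (he' : e' ∈ contacts 𝓑) {p : Point}
    (hp : p ∈ contactRect e) (hp' : p ∈ contactRect e') : e' = e := by
  obtain ⟨v, a⟩ := e
  obtain ⟨v', a'⟩ := e'
  rw [h𝓑.mem_contactRect he] at hp
  rw [h𝓑.mem_contactRect he'] at hp'
  obtain ⟨hv, ha, hcon⟩ := mem_contacts.1 he
  obtain ⟨hv', ha', hcon'⟩ := mem_contacts.1 he'
  rcases h𝓑.eq_or_eq_of_mem hv ha hv' hcon.ne hp.1 hp.2 hp'.1 with rfl | rfl <;>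
    rcases h𝓑.eq_or_eq_of_mem hv ha ha' hcon.ne hp.1 hp.2 hp'.2 with rfl | rfl
  · exact absurd rfl hcon'.ne
  · rfl
  · exact absurd hcon' hcon.not_symm
  · exact absurd rfl hcon'.ne

-- Inclusion-exclusion stops at pairs because no point is in three bricks.
open Classical in
theorem ind_body (p : Point) :
    ind (body 𝓑) p = ∑ B ∈ 𝓑, ind (Set.univ.pi fun i => Set.Icc (B.lower i) (B.upper i)) p -
      ∑ e ∈ contacts 𝓑, ind (contactRect e) p := by
  have hbox : ∀ B : Box, p ∈ (Set.univ.pi fun i => Set.Icc (B.lower i) (B.upper i)) ↔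
      p ∈ Box.Icc B := fun B => by rw [mem_box, Set.mem_univ_pi]; rfl
  unfold ind
  simp only [Finset.sum_boole, hbox]
  by_cases h0 : p ∈ body 𝓑
  · rw [if_pos h0]
    obtain ⟨B, hB, hpB⟩ := mem_body.1 h0
    by_cases huniq : ∀ B' ∈ 𝓑, p ∈ Box.Icc B' → B' = B
    · have h1 : 𝓑.filter (fun B => p ∈ Box.Icc B) = {B} := by
        ext B'; simp only [Finset.mem_filter, Finset.mem_singleton]
        exact ⟨fun h => huniq B' h.1 h.2, fun h => h ▸ ⟨hB, hpB⟩⟩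
      have h2 : (contacts 𝓑).filter (fun e => p ∈ contactRect e) = ∅ := by
        refine Finset.filter_eq_empty_iff.2 fun e he hpe => ?_
        rw [h𝓑.mem_contactRect he] at hpe
        obtain ⟨hv, ha, hcon⟩ := mem_contacts.1 he
        exact hcon.ne ((huniq _ hv hpe.1).trans (huniq _ ha hpe.2).symm)
      rw [h1, h2]; simp
    · push Not at huniq
      obtain ⟨B', hB', hpB', hne⟩ := huniq
      obtain ⟨v, a, hc, hpv, hpa⟩ : ∃ v a, (v, a) ∈ contacts 𝓑 ∧ p ∈ Box.Icc v ∧ p ∈ Box.Icc a := by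
        rcases h𝓑.contact_or hB hB' hne.symm ⟨p, hpB, hpB'⟩ with h | h
        · exact ⟨B, B', h, hpB, hpB'⟩
        · exact ⟨B', B, h, hpB', hpB⟩
      obtain ⟨hv, ha, hcon⟩ := mem_contacts.1 hc
      have hpc : p ∈ contactRect (v, a) := (h𝓑.mem_contactRect hc).2 ⟨hpv, hpa⟩
      have h1 : 𝓑.filter (fun B => p ∈ Box.Icc B) = {v, a} := by
        ext B'; simp only [Finset.mem_filter, Finset.mem_insert, Finset.mem_singleton]
        refine ⟨fun h => h𝓑.eq_or_eq_of_mem hv ha h.1 hcon.ne hpv hpa h.2, ?_⟩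
        rintro (rfl | rfl)
        · exact ⟨hv, hpv⟩
        · exact ⟨ha, hpa⟩
      have h2 : (contacts 𝓑).filter (fun e => p ∈ contactRect e) = {(v, a)} := by
        ext e; simp only [Finset.mem_filter, Finset.mem_singleton]
        exact ⟨fun h => h𝓑.contact_unique hc h.1 hpc h.2, fun h => h ▸ ⟨hc, hpc⟩⟩
      rw [h1, h2, Finset.card_pair hcon.ne]; simp
  · rw [if_neg h0]
    have h1 : 𝓑.filter (fun B => p ∈ Box.Icc B) = ∅ :=
      Finset.filter_eq_empty_iff.2 fun B hB hpB => h0 (mem_body.2 ⟨B, hB, hpB⟩)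
    have h2 : (contacts 𝓑).filter (fun e => p ∈ contactRect e) = ∅ := by
      refine Finset.filter_eq_empty_iff.2 fun e he hpe => h0 ?_
      rw [h𝓑.mem_contactRect he] at hpe
      exact mem_body.2 ⟨e.1, (mem_contacts.1 he).1, hpe.1⟩
    rw [h1, h2]; simp

-- The union is disjoint: open bricks do not overlap or meet contacts, and a point lies in at most
-- one contact.
open Classical in
theorem ind_interior (p : Point) :
    ind (interior (body 𝓑)) p =
      ∑ B ∈ 𝓑, ind (Set.univ.pi fun i => Set.Ioo (B.lower i) (B.upper i)) p +
      ∑ e ∈ contacts 𝓑, ind (contactInterior e) p := by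
  have hbox : ∀ B : Box, p ∈ (Set.univ.pi fun i => Set.Ioo (B.lower i) (B.upper i)) ↔
      ∀ i, B.lower i < p i ∧ p i < B.upper i := fun B => by simp
  have hcl : ∀ B : Box, (∀ i, B.lower i < p i ∧ p i < B.upper i) → p ∈ Box.Icc B := fun B h =>
    mem_box.2 fun i => ⟨(h i).1.le, (h i).2.le⟩
  have hexcl : ∀ B ∈ 𝓑, (∀ i, B.lower i < p i ∧ p i < B.upper i) →
      ∀ e ∈ contacts 𝓑, p ∉ contactRect e := by
    intro B hB hpB e he hpe
    have hpe' := (h𝓑.mem_contactRect he).1 hpe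
    obtain ⟨hv, ha, hcon⟩ := mem_contacts.1 he
    exact h𝓑.not_strict_of_contact he ((h𝓑.mem_contact_iff he).1 hpe').2
      (h𝓑.eq_or_eq_of_mem hv ha hB hcon.ne hpe'.1 hpe'.2 (hcl B hpB)) (hpB 2)
  unfold ind
  simp only [Finset.sum_boole, hbox, h𝓑.mem_interior_iff]
  simp only [← mem_contactInterior]
  by_cases h0 : ∃ B ∈ 𝓑, ∀ i, B.lower i < p i ∧ p i < B.upper i
  · rw [if_pos (Or.inl h0)]
    obtain ⟨B, hB, hpB⟩ := h0
    have h1 : 𝓑.filter (fun B => ∀ i, B.lower i < p i ∧ p i < B.upper i) = {B} := by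
      ext B'; simp only [Finset.mem_filter, Finset.mem_singleton]
      refine ⟨fun h => ?_, fun h => h ▸ ⟨hB, hpB⟩⟩
      by_contra hne
      rcases h𝓑.contact_or hB h.1 (Ne.symm hne) ⟨p, hcl B hpB, hcl B' h.2⟩ with hc | hc
      · exact hexcl B hB hpB _ hc ((h𝓑.mem_contactRect hc).2 ⟨hcl B hpB, hcl B' h.2⟩)
      · exact hexcl B hB hpB _ hc ((h𝓑.mem_contactRect hc).2 ⟨hcl B' h.2, hcl B hpB⟩)
    have h2 : (contacts 𝓑).filter (fun e => p ∈ contactInterior e) = ∅ :=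
      Finset.filter_eq_empty_iff.2 fun e he hpe =>
        hexcl B hB hpB e he (contactInterior_subset e hpe)
    rw [h1, h2]; simp
  · have h1 : 𝓑.filter (fun B => ∀ i, B.lower i < p i ∧ p i < B.upper i) = ∅ :=
      Finset.filter_eq_empty_iff.2 fun B hB hpB => h0 ⟨B, hB, hpB⟩
    rw [h1]
    by_cases h3 : ∃ e ∈ contacts 𝓑, p ∈ contactInterior e
    · rw [if_pos (Or.inr h3)]
      obtain ⟨e, he, hpe⟩ := h3
      have h2 : (contacts 𝓑).filter (fun e => p ∈ contactInterior e) = {e} := by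
        ext e'; simp only [Finset.mem_filter, Finset.mem_singleton]
        exact ⟨fun h => h𝓑.contact_unique he h.1 (contactInterior_subset e hpe)
          (contactInterior_subset e' h.2), fun h => h ▸ ⟨he, hpe⟩⟩
      rw [h2]; simp
    · rw [if_neg (not_or.2 ⟨h0, h3⟩)]
      have h2 : (contacts 𝓑).filter (fun e => p ∈ contactInterior e) = ∅ :=
        Finset.filter_eq_empty_iff.2 fun e he hpe => h3 ⟨e, he, hpe⟩
      rw [h2]; simp

include hX

/-- All sides of bricks and all contact heights are grid values, so membership in the frontier is
constant on a cell and can be tested at its midpoint. -/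
theorem openCell_subset_frontier_iff {c : Fin 3 → ℝ × ℝ}
    (hc : c ∈ Fintype.piFinset fun i => lineCells (X i)) :
    openCell c ⊆ frontier (body 𝓑) ↔ (fun i => cellMid (c i)) ∈ frontier (body 𝓑) := by
  rw [Fintype.mem_piFinset] at hc
  have hside := fun B (hB : B ∈ 𝓑) i => h𝓑.side_mem_grid hX hB i
  have hconst : ∀ p ∈ openCell c, p ∈ frontier (body 𝓑) ↔
      (fun i => cellMid (c i)) ∈ frontier (body 𝓑) := by
    intro p hp
    have hp' : ∀ i, p i ∈ openSegment ℝ (c i).1 (c i).2 := fun i => hp i (Set.mem_univ i)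
    rw [frontier, (isClosed_body 𝓑).closure_eq, Set.mem_sdiff, Set.mem_sdiff, mem_body, mem_body,
      h𝓑.mem_interior_iff, h𝓑.mem_interior_iff]
    have e1 : (∃ B ∈ 𝓑, p ∈ Box.Icc B) ↔ ∃ B ∈ 𝓑, (fun i => cellMid (c i)) ∈ Box.Icc B :=
      exists_congr fun B => and_congr_right fun hB => by
        rw [mem_box, mem_box]
        refine forall_congr' fun i => ?_
        exact and_congr (cell_const (hc i) (hside B hB i false) (hp' i)).1
          (cell_const (hc i) (hside B hB i true) (hp' i)).2.1
    have e2 : (∃ B ∈ 𝓑, ∀ i, B.lower i < p i ∧ p i < B.upper i) ↔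
        ∃ B ∈ 𝓑, ∀ i, B.lower i < cellMid (c i) ∧ cellMid (c i) < B.upper i :=
      exists_congr fun B => and_congr_right fun hB => forall_congr' fun i =>
        and_congr (cell_const (hc i) (hside B hB i false) (hp' i)).2.2.1
          (cell_const (hc i) (hside B hB i true) (hp' i)).2.2.2
    have e3 : (∃ e ∈ contacts 𝓑, (∀ i, i ≠ 2 → e.2.lower i < p i ∧ p i < e.2.upper i) ∧
        p 2 = height e.1 e.2) ↔ ∃ e ∈ contacts 𝓑, (∀ i, i ≠ 2 →
          e.2.lower i < cellMid (c i) ∧ cellMid (c i) < e.2.upper i) ∧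
          cellMid (c 2) = height e.1 e.2 :=
      exists_congr fun e => and_congr_right fun he => and_congr
        (forall_congr' fun i => imp_congr_right fun _ =>
          and_congr (cell_const (hc i) (hside _ (mem_contacts.1 he).2.1 i false) (hp' i)).2.2.1
            (cell_const (hc i) (hside _ (mem_contacts.1 he).2.1 i true) (hp' i)).2.2.2)
        (by
          have := cell_const (hc 2) (h𝓑.height_mem_grid hX he) (hp' 2)
          rw [le_antisymm_iff, le_antisymm_iff, this.1, this.2.1])
    rw [e1, e2, e3]
  have hmid : (fun i => cellMid (c i)) ∈ openCell c := fun i _ => cellMid_mem_openSegment (c i)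
  exact ⟨fun h => h hmid, fun h p hp => (hconst p hp).2 h⟩

/-- The frontier is the solid minus its interior. Closed bricks and closed contact rectangles count
`1`, open bricks `(-1) ^ 3`, open contact rectangles `(-1) ^ 2`, giving `(b - c) - (-b + c)`. -/
theorem boundaryEulerChar_eq :
    boundaryEulerChar (body 𝓑) X = 2 * ((𝓑.card : ℤ) - (contacts 𝓑).card) := by
  classical
  have h1 : boundaryEulerChar (body 𝓑) X = spaceEuler X (ind (frontier (body 𝓑))) := by
    unfold boundaryEulerChar spaceEuler ind
    rw [Finset.sum_filter]
    refine Finset.sum_congr rfl fun c hc => ?_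
    simp only [h𝓑.openCell_subset_frontier_iff hX hc, mul_ite, mul_one, mul_zero]
  have hfun : ind (frontier (body 𝓑)) = fun p =>
      (∑ B ∈ 𝓑, ind (Set.univ.pi fun i => Set.Icc (B.lower i) (B.upper i)) p -
        ∑ e ∈ contacts 𝓑, ind (contactRect e) p) -
      (∑ B ∈ 𝓑, ind (Set.univ.pi fun i => Set.Ioo (B.lower i) (B.upper i)) p +
        ∑ e ∈ contacts 𝓑, ind (contactInterior e) p) := by
    funext p
    rw [ind_frontier, h𝓑.ind_body, h𝓑.ind_interior]
  rw [h1, hfun, spaceEuler_sub, spaceEuler_sub, spaceEuler_add, spaceEuler_sum, spaceEuler_sum,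
    spaceEuler_sum, spaceEuler_sum]
  have a1 : ∀ B ∈ 𝓑,
      spaceEuler X (ind (Set.univ.pi fun i => Set.Icc (B.lower i) (B.upper i))) = 1 := by
    intro B hB
    rw [spaceEuler_pi]
    exact Finset.prod_eq_one fun i _ => lineEuler_Icc (h𝓑.side_mem_grid hX hB i false)
      (h𝓑.side_mem_grid hX hB i true) (B.lower_lt_upper i).le
  have a2 : ∀ B ∈ 𝓑,
      spaceEuler X (ind (Set.univ.pi fun i => Set.Ioo (B.lower i) (B.upper i))) = -1 := by
    intro B hB
    have o := fun i => lineEuler_Ioo (h𝓑.side_mem_grid hX hB i false)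
      (h𝓑.side_mem_grid hX hB i true) (B.lower_lt_upper i)
    simp only [side_false, side_true] at o
    simp [spaceEuler_pi, o, pow_succ]
  have a3 : ∀ e ∈ contacts 𝓑, spaceEuler X (ind (contactRect e)) = 1 := by
    intro e he
    rw [contactRect, spaceEuler_pi]
    refine Finset.prod_eq_one fun i _ => ?_
    have ha := (mem_contacts.1 he).2.1
    split_ifs with hi
    · subst hi
      exact lineEuler_Icc (h𝓑.height_mem_grid hX he) (h𝓑.height_mem_grid hX he) le_rfl
    · exact lineEuler_Icc (h𝓑.side_mem_grid hX ha i false)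
        (h𝓑.side_mem_grid hX ha i true) (e.2.lower_lt_upper i).le
  have a4 : ∀ e ∈ contacts 𝓑, spaceEuler X (ind (contactInterior e)) = 1 := by
    intro e he
    have ha := (mem_contacts.1 he).2.1
    have o := fun i => lineEuler_Ioo (h𝓑.side_mem_grid hX ha i false)
        (h𝓑.side_mem_grid hX ha i true) (e.2.lower_lt_upper i)
    have z := lineEuler_Icc (h𝓑.height_mem_grid hX he) (h𝓑.height_mem_grid hX he) le_rfl
    rw [contactInterior, spaceEuler_pi, Fin.prod_univ_three]
    simp only [side_false, side_true] at o
    simp only [if_pos, if_neg (show (0 : Fin 3) ≠ 2 by decide),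
      if_neg (show (1 : Fin 3) ≠ 2 by decide), o, z]
    norm_num
  rw [Finset.sum_congr rfl a1, Finset.sum_congr rfl a2, Finset.sum_congr rfl a3,
    Finset.sum_congr rfl a4]
  simp
  ring

end IsStackPartition

/-! ### Guards crossing vertical columns. -/

/-- The vertical column between height `h` and the brick `v`, over the horizontal section of `v`,
is contained in `P`. -/
def Column (P : Set Point) (h : ℝ) (v : Box) : Prop :=
  ∀ p : Point, (∀ i, i ≠ 2 → v.lower i ≤ p i ∧ p i ≤ v.upper i) →
    (∃ z, v.lower 2 ≤ z ∧ z ≤ v.upper 2 ∧ p 2 ∈ Set.uIcc h z) → p ∈ P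

/-- The guard `e` contains, up to endpoints, a segment at height `h` that crosses the vertical
column of the brick `v` along the line where coordinate `j` equals `ξ`. -/
structure Watches (P : Set Point) (e : Point × Point) (v : Box) (j : Fin 3) (ξ h : ℝ) : Prop where
  horizontal : j ≠ 2
  lower_le : v.lower j ≤ ξ
  le_upper : ξ ≤ v.upper j
  line : ∀ p : Point, p 2 = h → p j = ξ →
    (∀ i, i ≠ 2 → i ≠ j → v.lower i < p i ∧ p i < v.upper i) → p ∈ openSegment ℝ e.1 e.2
  column : Column P h v

/-- All points of the brick `v` are seen by open edge guards at the edges in `G`. -/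
def Guarded (P : Set Point) (G : Finset (Point × Point)) (v : Box) : Prop :=
  ∀ p ∈ Box.Icc v, ∃ e ∈ G, ∃ x ∈ openSegment ℝ e.1 e.2, Sees P x p

theorem Guarded.mono {P : Set Point} {G G' : Finset (Point × Point)} {v : Box}
    (h : Guarded P G v) (hG : G ⊆ G') : Guarded P G' v := fun p hp =>
  let ⟨e, he, hx⟩ := h p hp
  ⟨e, hG he, hx⟩

/-- A single point of the guard sees the whole brick: the column over the section of `v` from height
`h` through `v` is convex and lies in the solid. -/
theorem Watches.guarded {P : Set Point} {e : Point × Point} {v : Box} {j : Fin 3} {ξ h : ℝ}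
    (hw : Watches P e v j ξ h) {G : Finset (Point × Point)} (he : e ∈ G) : Guarded P G v := by
  intro p hp
  rw [mem_box] at hp
  set x : Point := fun i => if i = 2 then h else if i = j then ξ else (v.lower i + v.upper i) / 2
    with hx
  have hx2 : x 2 = h := by simp [hx]
  have hxj : x j = ξ := by simp [hx, hw.horizontal]
  have hxi : ∀ i, i ≠ 2 → i ≠ j → v.lower i < x i ∧ x i < v.upper i := by
    intro i hi hij
    have := v.lower_lt_upper i
    simp only [hx, hi, hij, if_false]
    constructor <;> linarith
  refine ⟨e, he, x, hw.line x hx2 hxj hxi, ?_⟩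
  rintro y ⟨a, b, ha, hb, hab, rfl⟩
  refine hw.column _ (fun i hi => ?_) ⟨p 2, (hp 2).1, (hp 2).2, ?_⟩
  · have hxI : x i ∈ Set.Icc (v.lower i) (v.upper i) := by
      by_cases hij : i = j
      · subst hij; rw [hxj]; exact ⟨hw.lower_le, hw.le_upper⟩
      · exact ⟨(hxi i hi hij).1.le, (hxi i hi hij).2.le⟩
    exact convex_Icc _ _ hxI (hp i) ha hb hab
  · have := convex_uIcc h (p 2) Set.left_mem_uIcc Set.right_mem_uIcc ha hb hab
    simpa [hx2] using this

/-- The edges that border the contacts. -/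
noncomputable def contactEdges (𝓑 : Finset Box) : Set (Point × Point) :=
  {g | ∃ e ∈ contacts 𝓑, g = contactEdge e.1 e.2}

namespace IsStackPartition

variable {𝓑 : Finset Box} (h𝓑 : IsStackPartition 𝓑)

theorem column_self {v : Box} (hv : v ∈ 𝓑) {h : ℝ} (h1 : v.lower 2 ≤ h) (h2 : h ≤ v.upper 2) :
    Column (body 𝓑) h v := by
  rintro p hp ⟨z, hz1, hz2, hz⟩
  have := Set.uIcc_subset_Icc (a₂ := v.lower 2) (b₂ := v.upper 2) ⟨h1, h2⟩ ⟨hz1, hz2⟩ hz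
  refine mem_body.2 ⟨v, hv, mem_box.2 fun i => ?_⟩
  by_cases hi : i = 2
  · subst hi; exact this
  · exact hp i hi

/-- The vertical path from `a` to height `h'` is split at `h`: one piece is in the column of `v`,
the other in `a` itself. This transfers visibility between bricks that need not touch. -/
theorem column_shift {v a : Box} (ha : a ∈ 𝓑) {h h' : ℝ} (hcol : Column (body 𝓑) h v)
    (h1 : v.lower 2 ≤ h') (h2 : h' ≤ v.upper 2) (h3 : a.lower 2 ≤ h) (h4 : h ≤ a.upper 2)
    (hsub : ∀ i, i ≠ 2 → v.lower i ≤ a.lower i ∧ a.upper i ≤ v.upper i) :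
    Column (body 𝓑) h' a := by
  rintro p hp ⟨z, hz1, hz2, hz⟩
  rcases Set.uIcc_subset_uIcc_union_uIcc (b := h) hz with hz' | hz'
  · exact hcol p (fun i hi => ⟨(hsub i hi).1.trans (hp i hi).1, (hp i hi).2.trans (hsub i hi).2⟩)
      ⟨h', h1, h2, Set.uIcc_comm h' h ▸ hz'⟩
  · exact column_self ha h3 h4 p hp ⟨z, hz1, hz2, hz'⟩

include h𝓑

theorem column_child {v a : Box} (hc : (v, a) ∈ contacts 𝓑) {h : ℝ}
    (hcol : Column (body 𝓑) h v) : Column (body 𝓑) h a := by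
  obtain ⟨hv, ha, hcon⟩ := mem_contacts.1 hc
  obtain ⟨l1, l2⟩ := h𝓑.height_mem_left hc
  obtain ⟨r1, r2⟩ := h𝓑.height_mem_right hc
  rintro p hp ⟨z, hz1, hz2, hz⟩
  rcases Set.uIcc_subset_uIcc_union_uIcc (b := height v a) hz with hz' | hz'
  · exact hcol p (fun i hi => ⟨(hcon.lower_le hi).trans (hp i hi).1,
      (hp i hi).2.trans (hcon.upper_le hi)⟩) ⟨_, l1, l2, hz'⟩
  · exact column_self ha r1 r2 p hp ⟨z, hz1, hz2, hz'⟩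

theorem watches_child {v a : Box} (hc : (v, a) ∈ contacts 𝓑) {e : Point × Point} {j : Fin 3}
    {ξ h : ℝ} (hw : Watches (body 𝓑) e v j ξ h) (h1 : a.lower j ≤ ξ) (h2 : ξ ≤ a.upper j) :
    Watches (body 𝓑) e a j ξ h := by
  have hcon := (mem_contacts.1 hc).2.2
  refine ⟨hw.horizontal, h1, h2, fun p hp2 hpj hp => hw.line p hp2 hpj fun i hi hij => ?_,
    h𝓑.column_child hc hw.column⟩
  exact ⟨(hcon.lower_le hi).trans_lt (hp i hi hij).1, (hp i hi hij).2.trans_le (hcon.upper_le hi)⟩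

/-- The narrowing happens along the guard, which is only cut shorter, so the child is still crossed.
-/
theorem watches_child_of_ne {v a : Box} (hc : (v, a) ∈ contacts 𝓑) {e : Point × Point}
    {j k : Fin 3} {s : Bool} {ξ h : ℝ} (hw : Watches (body 𝓑) e v j ξ h) (hf : FlushAt v a k s)
    (hk : k ≠ j) : Watches (body 𝓑) e a j ξ h := by
  obtain ⟨o1, o2⟩ := hf.other j hw.horizontal hk.symm
  exact h𝓑.watches_child hc hw (o1 ▸ hw.lower_le) (o2 ▸ hw.le_upper)

theorem watches_parent {v a : Box} (hc : (v, a) ∈ contacts 𝓑) {j : Fin 3} {s : Bool}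
    (hf : FlushAt v a j s) :
    Watches (body 𝓑) (contactEdge v a) v j (side a j (!s)) (height v a) := by
  obtain ⟨l1, l2⟩ := h𝓑.height_mem_left hc
  refine ⟨hf.horizontal, hf.lower_lt.le, hf.lt_upper.le, fun p hp2 hpj hp => ?_,
    column_self (mem_contacts.1 hc).1 l1 l2⟩
  refine hf.mem_openSegment.2 ⟨hp2, hpj, fun i hi hij => ?_⟩
  obtain ⟨o1, o2⟩ := hf.other i hi hij
  exact o1 ▸ o2 ▸ hp i hi hij

theorem watches_own {v a : Box} (hc : (v, a) ∈ contacts 𝓑) {j : Fin 3} {s : Bool}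
    (hf : FlushAt v a j s) :
    Watches (body 𝓑) (contactEdge v a) a j (side a j (!s)) (height v a) := by
  have := (a.lower_lt_upper j).le
  refine h𝓑.watches_child hc (h𝓑.watches_parent hc hf) ?_ ?_ <;> cases s <;> simp [this]

end IsStackPartition

/-! ### Guarding the branches of the forest. -/

open Classical in
/-- The smaller bricks that are joined to `v` in `F`. -/
noncomputable def children (𝓑 : Finset Box) (F : Finset (Box × Box)) (v : Box) : Finset Box :=
  𝓑.filter fun a => (v, a) ∈ F

open Classical in
/-- The number of narrower bricks. -/
noncomputable def girthRank (𝓑 : Finset Box) (v : Box) : ℕ :=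
  (𝓑.filter fun w => girth w < girth v).card

theorem mem_children {𝓑 : Finset Box} {F : Finset (Box × Box)} (hsub : F ⊆ contacts 𝓑)
    {v a : Box} : a ∈ children 𝓑 F v ↔ (v, a) ∈ F := by
  classical
  rw [children, Finset.mem_filter, and_iff_right_iff_imp]
  exact fun h => (mem_contacts.1 (hsub h)).2.1

theorem girthRank_lt {𝓑 : Finset Box} {F : Finset (Box × Box)} (hsub : F ⊆ contacts 𝓑) {v a : Box}
    (h : (v, a) ∈ F) : girthRank 𝓑 a < girthRank 𝓑 v := by
  classical
  obtain ⟨-, ha, hcon⟩ := mem_contacts.1 (hsub h)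
  obtain ⟨j, s, hf⟩ := hcon.flush
  refine Finset.card_lt_card ⟨fun w hw => ?_, fun hss => ?_⟩
  · simp only [Finset.mem_filter] at hw ⊢
    exact ⟨hw.1, hw.2.trans hf.girth_lt⟩
  · have := hss (Finset.mem_filter.2 ⟨ha, hf.girth_lt⟩)
    simp at this

/-- A set of contacts in which every brick with a larger neighbor has either no smaller neighbors or
two of them, lying at opposite ends of it, where `cost` bounds the number of such branchings. -/
structure IsBranching (𝓑 : Finset Box) (F : Finset (Box × Box)) (cost : Box → ℕ) : Prop where
  sub : F ⊆ contacts 𝓑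
  split : ∀ u v, (u, v) ∈ F → children 𝓑 F v = ∅ ∨ ∃ (k : Fin 3) (c : Bool → Box),
    (∀ a, a ∈ children 𝓑 F v ↔ ∃ s, a = c s) ∧ (∀ s, FlushAt v (c s) k s) ∧
      1 + cost (c false) + cost (c true) ≤ cost v

/-- The bricks that can be reached from `v` along `F` are guarded. -/
def Serves (𝓑 : Finset Box) (F : Finset (Box × Box)) (G : Finset (Point × Point)) (v : Box) :
    Prop :=
  ∀ w, Relation.ReflTransGen (fun v a => (v, a) ∈ F) v w → Guarded (body 𝓑) G w

theorem Serves.mono {𝓑 : Finset Box} {F : Finset (Box × Box)} {G G' : Finset (Point × Point)}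
    {v : Box} (h : Serves 𝓑 F G v) (hG : G ⊆ G') : Serves 𝓑 F G' v := fun w hw => (h w hw).mono hG

namespace IsBranching

variable {𝓑 : Finset Box} {F : Finset (Box × Box)} {cost : Box → ℕ}
  (hF : IsBranching 𝓑 F cost)
include hF

theorem serves_of_children {G : Finset (Point × Point)} {v : Box} (hv : Guarded (body 𝓑) G v)
    (h : ∀ a ∈ children 𝓑 F v, Serves 𝓑 F G a) : Serves 𝓑 F G v := by
  intro w hw
  rcases hw.cases_head with rfl | ⟨a, ha, haw⟩
  · exact hv
  · exact h a ((mem_children hF.sub).2 ha) w haw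

variable (h𝓑 : IsStackPartition 𝓑)
include h𝓑

/-- The branch at `v` can be guarded by a guard that crosses the column of `v`, together with
`cost v` further ones, provided that the guard lies on a side of `v` or that its position is fixed
in the direction in which `v` is as wide as its parent. -/
theorem exists_serves (n : ℕ) : ∀ u v, (u, v) ∈ F → girthRank 𝓑 v < n →
    ∀ l t, FlushAt u v l t → ∀ g j ξ h, Watches (body 𝓑) g v j ξ h →
      ((∃ s, ξ = side v j s) ∨ l ≠ j) →
      ∃ G : Finset (Point × Point), (G : Set (Point × Point)) ⊆ contactEdges 𝓑 ∧
        G.card ≤ cost v ∧ Serves 𝓑 F (insert g G) v := by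
  classical
  induction n with
  | zero => intro u v _ h; exact absurd h (Nat.not_lt_zero _)
  | succ n ih =>
    intro u v huv hn l t hl g j ξ h hw hcase
    rcases hF.split u v huv with hch | ⟨k, c, hch, hflush, hcost⟩
    · refine ⟨∅, by simp, by simp, hF.serves_of_children (hw.guarded (by simp)) ?_⟩
      simp [hch]
    have hcF : ∀ s, (v, c s) ∈ F := fun s => (mem_children hF.sub).1 ((hch _).2 ⟨s, rfl⟩)
    have hcc : ∀ s, (v, c s) ∈ contacts 𝓑 := fun s => hF.sub (hcF s)
    have hrank : ∀ s, girthRank 𝓑 (c s) < n := fun s => by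
      have := girthRank_lt hF.sub (hcF s); omega
    have hrec := fun s => ih v (c s) (hcF s) (hrank s) k s (hflush s)
    have hserve : ∀ G, Guarded (body 𝓑) G v → Serves 𝓑 F G (c false) → Serves 𝓑 F G (c true) →
        Serves 𝓑 F G v := fun G h1 h2 h3 => hF.serves_of_children h1 (by
      intro a ha
      obtain ⟨s, rfl⟩ := (hch a).1 ha
      cases s
      · exact h2
      · exact h3)
    by_cases hkj : k = j
    · subst hkj
      by_cases hs : ∃ s, ξ = side v k s
      -- A guard over the side `s` of `v` is also over the side `s` of the child flush there. The
      -- other child uses the edge of its own contact, which pays for the branching.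
      · obtain ⟨s, rfl⟩ := hs
        have hle := ((c s).lower_lt_upper k).le
        have hfl := (hflush s).flush
        obtain ⟨G₁, hG₁, hc₁, hs₁⟩ := hrec s g k _ h (h𝓑.watches_child (hcc s) hw
          (by rw [← hfl]; cases s <;> simp [hle]) (by rw [← hfl]; cases s <;> simp [hle]))
          (Or.inl ⟨s, hfl.symm⟩)
        obtain ⟨G₂, hG₂, hc₂, hs₂⟩ := hrec (!s) _ k _ _
          (h𝓑.watches_own (hcc (!s)) (hflush (!s))) (Or.inl ⟨_, rfl⟩)
        refine ⟨G₁ ∪ insert (contactEdge v (c (!s))) G₂, ?_, ?_, ?_⟩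
        · simp only [Finset.coe_union, Finset.coe_insert, Set.union_subset_iff,
            Set.insert_subset_iff]
          exact ⟨hG₁, ⟨_, hcc (!s), rfl⟩, hG₂⟩
        · refine (Finset.card_union_le _ _).trans ?_
          have := Finset.card_insert_le (contactEdge v (c (!s))) G₂
          cases s <;> simp at * <;> omega
        · have s₁ := hs₁.mono (G' := insert g (G₁ ∪ insert (contactEdge v (c (!s))) G₂)) (by grind)
          have s₂ := hs₂.mono (G' := insert g (G₁ ∪ insert (contactEdge v (c (!s))) G₂)) (by grind)
          refine hserve _ (hw.guarded (by simp)) ?_ ?_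
          · cases s
            · exact s₁
            · exact s₂
          · cases s
            · exact s₂
            · exact s₁
      -- The guard may miss both children. The edge between `v` and its parent crosses the column of
      -- `v` perpendicularly to direction `l`, and since the children are narrower in `k ≠ l`, this
      -- one new guard reaches both.
      · have hlk : l ≠ k := hcase.resolve_left hs
        have hwu := h𝓑.watches_own (hF.sub huv) hl
        have hrec' := fun s => hrec s _ l _ _
          (h𝓑.watches_child_of_ne (hcc s) hwu (hflush s) hlk.symm) (Or.inr hlk.symm)
        obtain ⟨G₁, hG₁, hc₁, hs₁⟩ := hrec' false
        obtain ⟨G₂, hG₂, hc₂, hs₂⟩ := hrec' true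
        refine ⟨insert (contactEdge u v) (G₁ ∪ G₂), ?_, ?_, ?_⟩
        · simp only [Finset.coe_union, Finset.coe_insert, Set.union_subset_iff,
            Set.insert_subset_iff]
          exact ⟨⟨_, hF.sub huv, rfl⟩, hG₁, hG₂⟩
        · refine (Finset.card_insert_le _ _).trans ?_
          have := Finset.card_union_le G₁ G₂
          omega
        · exact hserve _ (hw.guarded (by simp)) (hs₁.mono (by grind)) (hs₂.mono (by grind))
    -- The guard reaches both children, and their direction of narrowing differs from `j`, so the
    -- second alternative passes on; no new guard is needed.
    · have hrec' := fun s => hrec s g j ξ h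
        (h𝓑.watches_child_of_ne (hcc s) hw (hflush s) hkj) (Or.inr hkj)
      obtain ⟨G₁, hG₁, hc₁, hs₁⟩ := hrec' false
      obtain ⟨G₂, hG₂, hc₂, hs₂⟩ := hrec' true
      refine ⟨G₁ ∪ G₂, ?_, ?_, ?_⟩
      · simpa using ⟨hG₁, hG₂⟩
      · have := Finset.card_union_le G₁ G₂
        omega
      · exact hserve _ (hw.guarded (by simp)) (hs₁.mono (by grind)) (hs₂.mono (by grind))

/-- The branch at `v` can be guarded by the edge that borders the contact of `v` with its parent and
`cost v` further guards. -/
theorem exists_serves_own {u v : Box} (huv : (u, v) ∈ F) :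
    ∃ G : Finset (Point × Point), (G : Set (Point × Point)) ⊆ contactEdges 𝓑 ∧
      G.card ≤ 1 + cost v ∧ Serves 𝓑 F G v ∧ contactEdge u v ∈ G := by
  classical
  obtain ⟨l, t, hl⟩ := (mem_contacts.1 (hF.sub huv)).2.2.flush
  obtain ⟨G, hG, hc, hs⟩ := hF.exists_serves h𝓑 _ u v huv (Nat.lt_succ_self _) l t hl _ l _ _
    (h𝓑.watches_own (hF.sub huv) hl) (Or.inl ⟨_, rfl⟩)
  refine ⟨insert (contactEdge u v) G, ?_, ?_, hs, by simp⟩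
  · rw [Finset.coe_insert, Set.insert_subset_iff]
    exact ⟨⟨_, hF.sub huv, rfl⟩, hG⟩
  · have := Finset.card_insert_le (contactEdge u v) G
    omega

end IsBranching

namespace IsBranching

variable {𝓑 : Finset Box} {F : Finset (Box × Box)} {cost : Box → ℕ}
  (hF : IsBranching 𝓑 F cost) (h𝓑 : IsStackPartition 𝓑)

/-- Two branches at bricks `t` and `x` that are narrower than their parents in the same direction,
with equal extents in the other one, and flush at the same side. -/
structure Opposite (𝓑 : Finset Box) (F : Finset (Box × Box)) (j : Fin 3) (s : Bool)
    (pt t px x : Box) : Prop where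
  left : (pt, t) ∈ F
  right : (px, x) ∈ F
  flush_left : FlushAt pt t j s
  flush_right : FlushAt px x j s
  side_eq : side t j s = side x j s
  other : ∀ i, i ≠ 2 → i ≠ j → t.lower i = x.lower i ∧ t.upper i = x.upper i
  column_left : Column (body 𝓑) (height px x) t
  column_right : Column (body 𝓑) (height pt t) x

theorem Opposite.symm {j : Fin 3} {s : Bool} {pt t px x : Box} (h : Opposite 𝓑 F j s pt t px x) :
    Opposite 𝓑 F j s px x pt t :=
  ⟨h.right, h.left, h.flush_right, h.flush_left, h.side_eq.symm,
    fun i hi hij => ⟨(h.other i hi hij).1.symm, (h.other i hi hij).2.symm⟩, h.column_right,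
    h.column_left⟩

theorem Opposite.subset_or {j : Fin 3} {s : Bool} {pt t px x : Box}
    (h : Opposite 𝓑 F j s pt t px x) :
    (∀ i, i ≠ 2 → t.lower i ≤ x.lower i ∧ x.upper i ≤ t.upper i) ∨
      ∀ i, i ≠ 2 → x.lower i ≤ t.lower i ∧ t.upper i ≤ x.upper i := by
  have hs := h.side_eq
  have key : (t.lower j ≤ x.lower j ∧ x.upper j ≤ t.upper j) ∨
      (x.lower j ≤ t.lower j ∧ t.upper j ≤ x.upper j) := by
    cases s <;> simp at hs <;> simp only [hs, le_refl, true_and, and_true]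
    · exact le_total _ _
    · exact le_total _ _
  refine key.imp (fun k i hi => ?_) (fun k i hi => ?_) <;> by_cases hij : i = j
  · subst hij; exact k
  · exact ⟨(h.other i hi hij).1.le, (h.other i hi hij).2.ge⟩
  · subst hij; exact k
  · exact ⟨(h.other i hi hij).1.ge, (h.other i hi hij).2.le⟩

include hF h𝓑

/-- The edge above or below the narrower brick `x` also crosses the column of the wider `t`. If the
children of `t` narrow along that edge, it continues into both. Otherwise the child flush at the
common side `s` is again opposite to `x`, and the induction hypothesis serves the two together; the
remaining child pays for itself with the branching at `t`. -/
theorem exists_serves_opposite_step {j : Fin 3} {s : Bool} {pt t px x : Box}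
    (hop : Opposite 𝓑 F j s pt t px x)
    (hsub : ∀ i, i ≠ 2 → t.lower i ≤ x.lower i ∧ x.upper i ≤ t.upper i)
    (ih : ∀ t', (t, t') ∈ F → Opposite 𝓑 F j s t t' px x →
      ∃ G : Finset (Point × Point), (G : Set (Point × Point)) ⊆ contactEdges 𝓑 ∧
        G.card ≤ 1 + cost t' + cost x ∧ Serves 𝓑 F G t' ∧ Serves 𝓑 F G x) :
    ∃ G : Finset (Point × Point), (G : Set (Point × Point)) ⊆ contactEdges 𝓑 ∧
      G.card ≤ 1 + cost t + cost x ∧ Serves 𝓑 F G t ∧ Serves 𝓑 F G x := by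
  classical
  have hxc := hF.sub hop.right
  have hx := (mem_contacts.1 hxc).2.1
  obtain ⟨l1, l2⟩ := h𝓑.height_mem_right hxc
  have hwx := h𝓑.watches_own hxc hop.flush_right
  have hwt : Watches (body 𝓑) (contactEdge px x) t j (side x j (!s)) (height px x) :=
    ⟨hwx.horizontal, (hsub j hwx.horizontal).1.trans hwx.lower_le,
      hwx.le_upper.trans (hsub j hwx.horizontal).2, fun p hp2 hpj hp => hwx.line p hp2 hpj
        fun i hi hij => (hop.other i hi hij).1 ▸ (hop.other i hi hij).2 ▸ hp i hi hij,
      hop.column_left⟩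
  obtain ⟨G₀, hG₀, hc₀, hs₀, hm₀⟩ := hF.exists_serves_own h𝓑 hop.right
  rcases hF.split pt t hop.left with hch | ⟨k, c, hch, hflush, hcost⟩
  · exact ⟨G₀, hG₀, by omega, hF.serves_of_children (hwt.guarded hm₀) (by simp [hch]), hs₀⟩
  have hcF : ∀ s, (t, c s) ∈ F := fun s => (mem_children hF.sub).1 ((hch _).2 ⟨s, rfl⟩)
  have hcc : ∀ s, (t, c s) ∈ contacts 𝓑 := fun s => hF.sub (hcF s)
  by_cases hkj : k = j
  · subst hkj
    have hop' : Opposite 𝓑 F k s t (c s) px x := by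
      refine ⟨hcF s, hop.right, hflush s, hop.flush_right,
        (hflush s).flush.trans hop.side_eq, fun i hi hij => ?_,
        h𝓑.column_child (hcc s) hop.column_left, ?_⟩
      · obtain ⟨o1, o2⟩ := (hflush s).other i hi hij
        obtain ⟨o3, o4⟩ := hop.other i hi hij
        exact ⟨o1.symm.trans o3, o2.symm.trans o4⟩
      · obtain ⟨m1, m2⟩ := h𝓑.height_mem_left (hcc s)
        exact IsStackPartition.column_shift hx hop.column_left m1 m2 l1 l2 hsub
    obtain ⟨G₁, hG₁, hc₁, hs₁, hx₁⟩ := ih (c s) (hcF s) hop'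
    -- The edge of this contact lies in this guard set and sees `t` as well.
    obtain ⟨G₂, hG₂, hc₂, hs₂, hm₂⟩ := hF.exists_serves_own h𝓑 (hcF (!s))
    refine ⟨G₁ ∪ G₂, by simpa using ⟨hG₁, hG₂⟩, ?_, hF.serves_of_children
      ((h𝓑.watches_parent (hcc (!s)) (hflush (!s))).guarded (Finset.mem_union_right _ hm₂)) ?_,
      hx₁.mono Finset.subset_union_left⟩
    · have := Finset.card_union_le G₁ G₂
      cases s <;> simp at * <;> omega
    · intro a ha
      obtain ⟨s', rfl⟩ := (hch a).1 ha
      rcases Bool.eq_or_eq_not s' s with rfl | rfl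
      · exact hs₁.mono Finset.subset_union_left
      · exact hs₂.mono Finset.subset_union_right
  · have hrec := fun s => hF.exists_serves h𝓑 _ t (c s) (hcF s) (Nat.lt_succ_self _) k s (hflush s)
      _ j _ _ (h𝓑.watches_child_of_ne (hcc s) hwt (hflush s) hkj) (Or.inr hkj)
    obtain ⟨G₁, hG₁, hc₁, hs₁⟩ := hrec false
    obtain ⟨G₂, hG₂, hc₂, hs₂⟩ := hrec true
    refine ⟨G₀ ∪ (G₁ ∪ G₂), by simpa using ⟨hG₀, hG₁, hG₂⟩, ?_, hF.serves_of_children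
      (hwt.guarded (Finset.mem_union_left _ hm₀)) ?_, hs₀.mono Finset.subset_union_left⟩
    · have := Finset.card_union_le G₁ G₂
      have := Finset.card_union_le G₀ (G₁ ∪ G₂)
      omega
    · intro a ha
      obtain ⟨s', rfl⟩ := (hch a).1 ha
      cases s'
      · exact hs₁.mono (by grind)
      · exact hs₂.mono (by grind)

/-- The flush sides and the other extents agree, so one section contains the other; the step
descends on the wider branch, lowering the sum of the two ranks. -/
theorem exists_serves_opposite {j : Fin 3} {s : Bool} (n : ℕ) : ∀ pt t px x,
    Opposite 𝓑 F j s pt t px x → girthRank 𝓑 t + girthRank 𝓑 x < n →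
    ∃ G : Finset (Point × Point), (G : Set (Point × Point)) ⊆ contactEdges 𝓑 ∧
      G.card ≤ 1 + cost t + cost x ∧ Serves 𝓑 F G t ∧ Serves 𝓑 F G x := by
  induction n with
  | zero => intro _ _ _ _ _ h; exact absurd h (Nat.not_lt_zero _)
  | succ n ih =>
    intro pt t px x hop hn
    rcases hop.subset_or with hsub | hsub
    · refine hF.exists_serves_opposite_step h𝓑 hop hsub fun t' ht' hop' => ih t t' px x hop' ?_
      have := girthRank_lt hF.sub ht'
      omega
    · obtain ⟨G, hG, hc, h1, h2⟩ := hF.exists_serves_opposite_step h𝓑 hop.symm hsub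
        fun x' hx' hop' => ih x x' pt t hop' (by
          have := girthRank_lt hF.sub hx'
          omega)
      exact ⟨G, hG, by omega, h2, h1⟩

theorem exists_serves_root_one {v a : Box} (ha : (v, a) ∈ F)
    (hch : ∀ b ∈ children 𝓑 F v, b = a) (hcost : cost a ≤ cost v) :
    ∃ G : Finset (Point × Point), (G : Set (Point × Point)) ⊆ contactEdges 𝓑 ∧
      G.card ≤ 1 + cost v ∧ Serves 𝓑 F G v := by
  obtain ⟨j, s, hf⟩ := (mem_contacts.1 (hF.sub ha)).2.2.flush
  obtain ⟨G, hG, hc, hs, hm⟩ := hF.exists_serves_own h𝓑 ha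
  refine ⟨G, hG, by omega, hF.serves_of_children
    ((h𝓑.watches_parent (hF.sub ha) hf).guarded hm) fun b hb => ?_⟩
  rw [hch b hb]; exact hs

/-- Serving three branches separately would take one guard too many. If `x` narrows in another
direction than the pair, an edge of the pair crosses `x` too; otherwise `x` and the member of the
pair flush at the same side share a guard. -/
theorem exists_serves_root_three {v x : Box} {k j : Fin 3} {s : Bool} {c : Bool → Box}
    (hc : ∀ s, (v, c s) ∈ F) (hx : (v, x) ∈ F)
    (hch : ∀ b ∈ children 𝓑 F v, (∃ s, b = c s) ∨ b = x)
    (hfc : ∀ s, FlushAt v (c s) k s) (hfx : FlushAt v x j s)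
    (hcost : 1 + cost (c false) + cost (c true) + cost x ≤ cost v) :
    ∃ G : Finset (Point × Point), (G : Set (Point × Point)) ⊆ contactEdges 𝓑 ∧
      G.card ≤ 1 + cost v ∧ Serves 𝓑 F G v := by
  classical
  have hcc := fun s => hF.sub (hc s)
  have hxc := hF.sub hx
  have hwv := fun s => h𝓑.watches_parent (hcc s) (hfc s)
  by_cases hjk : j = k
  · subst hjk
    have hop : Opposite 𝓑 F j s v (c s) v x := by
      refine ⟨hc s, hx, hfc s, hfx, (hfc s).flush.trans hfx.flush.symm, fun i hi hij => ?_, ?_, ?_⟩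
      · obtain ⟨o1, o2⟩ := (hfc s).other i hi hij
        obtain ⟨o3, o4⟩ := hfx.other i hi hij
        exact ⟨o1.symm.trans o3, o2.symm.trans o4⟩
      · exact h𝓑.column_child (hcc s) (h𝓑.watches_parent hxc hfx).column
      · exact h𝓑.column_child hxc (hwv s).column
    obtain ⟨G₁, hG₁, hc₁, hs₁, hx₁⟩ := hF.exists_serves_opposite h𝓑 _ _ _ _ _ hop
      (Nat.lt_succ_self _)
    obtain ⟨G₂, hG₂, hc₂, hs₂, hm₂⟩ := hF.exists_serves_own h𝓑 (hc (!s))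
    refine ⟨G₁ ∪ G₂, by simpa using ⟨hG₁, hG₂⟩, ?_, hF.serves_of_children
      ((hwv (!s)).guarded (Finset.mem_union_right _ hm₂)) ?_⟩
    · have := Finset.card_union_le G₁ G₂
      cases s <;> simp at * <;> omega
    · intro a ha
      rcases hch a ha with ⟨s', rfl⟩ | rfl
      · rcases Bool.eq_or_eq_not s' s with rfl | rfl
        · exact hs₁.mono Finset.subset_union_left
        · exact hs₂.mono Finset.subset_union_right
      · exact hx₁.mono Finset.subset_union_left
  · have hwx := h𝓑.watches_child_of_ne hxc (hwv false) hfx hjk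
    obtain ⟨G₀, hG₀, hc₀, hs₀⟩ := hF.exists_serves h𝓑 _ v x hx (Nat.lt_succ_self _) j s hfx _ k _ _
      hwx (Or.inr hjk)
    obtain ⟨G₁, hG₁, hc₁, hs₁, hm₁⟩ := hF.exists_serves_own h𝓑 (hc false)
    obtain ⟨G₂, hG₂, hc₂, hs₂, hm₂⟩ := hF.exists_serves_own h𝓑 (hc true)
    refine ⟨G₀ ∪ (G₁ ∪ G₂), by simpa using ⟨hG₀, hG₁, hG₂⟩, ?_, hF.serves_of_children
      ((hwv false).guarded (by simp [hm₁])) ?_⟩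
    · have := Finset.card_union_le G₁ G₂
      have := Finset.card_union_le G₀ (G₁ ∪ G₂)
      omega
    · intro a ha
      rcases hch a ha with ⟨s', rfl⟩ | rfl
      · cases s'
        · exact hs₁.mono (by grind)
        · exact hs₂.mono (by grind)
      · refine hs₀.mono (Finset.insert_subset ?_ Finset.subset_union_left)
        simp [hm₁]

end IsBranching

/-! ### Bricks on a common face. -/

/-- The brick `w` touches `v` at the top (`σ = true`) or bottom (`σ = false`) of `v`. -/
structure TouchesAt (v w : Box) (σ : Bool) : Prop where
  nonempty : (Box.Icc v ∩ Box.Icc w).Nonempty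
  level : side v 2 σ = side w 2 (!σ)

namespace IsStackPartition

variable {𝓑 : Finset Box} (h𝓑 : IsStackPartition 𝓑)
include h𝓑

theorem touchesAt_right {v a : Box} (hc : (v, a) ∈ contacts 𝓑) : ∃ σ, TouchesAt v a σ := by
  obtain ⟨σ, h1, h2⟩ := h𝓑.height_spec hc
  exact ⟨σ, (mem_contacts.1 hc).2.2.nonempty, h1.trans h2.symm⟩

theorem touchesAt_left {v a : Box} (hc : (v, a) ∈ contacts 𝓑) : ∃ σ, TouchesAt a v σ := by
  obtain ⟨σ, h1, h2⟩ := h𝓑.height_spec hc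
  refine ⟨!σ, Set.inter_comm _ _ ▸ (mem_contacts.1 hc).2.2.nonempty, ?_⟩
  rw [Bool.not_not]; exact h2.trans h1.symm

theorem disjoint_of_touchesAt {v w w' : Box} {σ : Bool} (hw : w ∈ 𝓑) (hw' : w' ∈ 𝓑)
    (hne : w ≠ w') (h : TouchesAt v w σ) (h' : TouchesAt v w' σ) {p : Point}
    (hp : p ∈ Box.Icc w) (hp' : p ∈ Box.Icc w') : False := by
  have e := h.level.symm.trans h'.level
  have l := w.lower_lt_upper 2
  have l' := w'.lower_lt_upper 2
  rcases h𝓑.touch w hw w' hw' hne ⟨p, hp, hp'⟩ with ht | ht <;> cases σ <;> simp at e <;> linarith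

/-- A larger neighbor covers the entire face of `v`, so another brick there would meet it on the
same side of the plane, where distinct bricks are disjoint. -/
theorem not_touchesAt_of_parent {u v w : Box} {σ : Bool} (hc : (u, v) ∈ contacts 𝓑) (hw : w ∈ 𝓑)
    (hne : u ≠ w) (h : TouchesAt v u σ) : ¬ TouchesAt v w σ := by
  intro h'
  obtain ⟨hu, hv, hcon⟩ := mem_contacts.1 hc
  obtain ⟨p, hpv, hpw⟩ := h'.nonempty
  refine h𝓑.disjoint_of_touchesAt hu hw hne h h' (mem_box.2 fun i => ?_) hpw
  have b := mem_box.1 hpv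
  by_cases hi : i = 2
  · subst hi
    have e := h.level
    have e' := h'.level
    have b2 := b 2
    have b2' := mem_box.1 hpw 2
    have l := u.lower_lt_upper 2
    cases σ <;> simp at e e' <;> constructor <;> linarith
  · exact ⟨(hcon.lower_le hi).trans (b i).1, (b i).2.trans (hcon.upper_le hi)⟩

/-- Unless they are flush at opposite ends in the same direction, the two bricks share a corner of
the face of `v`, but bricks on one face are disjoint. -/
theorem opposite_of_touchesAt {v a a' : Box} {σ : Bool} (ha : a ∈ 𝓑) (ha' : a' ∈ 𝓑)
    (hne : a ≠ a') {j j' : Fin 3} {s s' : Bool} (hf : FlushAt v a j s) (hf' : FlushAt v a' j' s')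
    (h : TouchesAt v a σ) (h' : TouchesAt v a' σ) : j' = j ∧ s' = !s := by
  by_contra hcon
  have hjs : j' = j → s' = s := fun hj => by
    have : ¬ s' = !s := fun hs => hcon ⟨hj, hs⟩
    cases s <;> cases s' <;> simp_all
  -- The common corner: in direction `j` it is the flush side of `a`. The other horizontal
  -- coordinate matters for `a'` only if that is `j'`, and then it is its flush side.
  set q : Point := fun k => if k = 2 then side v 2 σ else if k = j then side v j s else side v k s'
    with hq
  have hj := hf.horizontal
  have hj' := hf'.horizontal
  have mem : ∀ (B : Box) (k : Fin 3) (t : Bool), B.lower k ≤ side B k t ∧ side B k t ≤ B.upper k :=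
    fun B k t => by have := (B.lower_lt_upper k).le; cases t <;> simp [this]
  have oth : ∀ {w : Box} {l : Fin 3} {t : Bool}, FlushAt v w l t → ∀ k, k ≠ 2 → k ≠ l → ∀ r,
      side v k r = side w k r := fun hw k hk hkl r => by
    obtain ⟨o1, o2⟩ := hw.other k hk hkl; cases r <;> assumption
  refine h𝓑.disjoint_of_touchesAt ha ha' hne h h' (p := q) (mem_box.2 fun k => ?_)
    (mem_box.2 fun k => ?_)
  · by_cases hk : k = 2
    · subst hk; simp only [hq, if_true]; rw [h.level]; exact mem _ _ _
    · by_cases hkj : k = j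
      · subst hkj; simp only [hq, hk, if_true, if_false]; rw [← hf.flush]; exact mem _ _ _
      · simp only [hq, hk, hkj, if_false]; rw [oth hf k hk hkj]; exact mem _ _ _
  · by_cases hk : k = 2
    · subst hk; simp only [hq, if_true]; rw [h'.level]; exact mem _ _ _
    · by_cases hkj : k = j
      · subst hkj; simp only [hq, hk, if_true, if_false]
        by_cases hkj' : k = j'
        · subst hkj'; rw [← hjs rfl, ← hf'.flush]; exact mem _ _ _
        · rw [oth hf' k hk hkj']; exact mem _ _ _
      · simp only [hq, hk, hkj, if_false]
        by_cases hkj' : k = j'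
        · subst hkj'; rw [← hf'.flush]; exact mem _ _ _
        · rw [oth hf' k hk hkj']; exact mem _ _ _

theorem not_three_touchesAt {v a b c : Box} {σ : Bool} (ha : (v, a) ∈ contacts 𝓑)
    (hb : (v, b) ∈ contacts 𝓑) (hc : (v, c) ∈ contacts 𝓑) (hab : a ≠ b) (hac : a ≠ c) (hbc : b ≠ c)
    (ta : TouchesAt v a σ) (tb : TouchesAt v b σ) : ¬ TouchesAt v c σ := by
  intro tc
  obtain ⟨-, ha, ca⟩ := mem_contacts.1 ha
  obtain ⟨-, hb, cb⟩ := mem_contacts.1 hb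
  obtain ⟨-, hc, cc⟩ := mem_contacts.1 hc
  obtain ⟨j, s, fa⟩ := ca.flush
  obtain ⟨j', s', fb⟩ := cb.flush
  obtain ⟨j'', s'', fc⟩ := cc.flush
  have h1 := (h𝓑.opposite_of_touchesAt ha hb hab fa fb ta tb).2
  have h2 := (h𝓑.opposite_of_touchesAt ha hc hac fa fc ta tc).2
  have h3 := (h𝓑.opposite_of_touchesAt hb hc hbc fb fc tb tc).2
  subst h1; subst h2
  cases s <;> simp at h3

/-- Two smaller bricks on the same side of `v` are flush with it at opposite ends. -/
theorem exists_pair {v a b : Box} {σ : Bool} (ha : (v, a) ∈ contacts 𝓑) (hb : (v, b) ∈ contacts 𝓑)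
    (hab : a ≠ b) (ta : TouchesAt v a σ) (tb : TouchesAt v b σ) :
    ∃ (k : Fin 3) (c : Bool → Box), (∀ s, FlushAt v (c s) k s) ∧
      (∀ w, (∃ s, w = c s) ↔ w = a ∨ w = b) ∧ c false ≠ c true := by
  classical
  obtain ⟨-, ha, ca⟩ := mem_contacts.1 ha
  obtain ⟨-, hb, cb⟩ := mem_contacts.1 hb
  obtain ⟨j, s, fa⟩ := ca.flush
  obtain ⟨j', s', fb⟩ := cb.flush
  obtain ⟨rfl, rfl⟩ := h𝓑.opposite_of_touchesAt ha hb hab fa fb ta tb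
  refine ⟨j', fun t => if t = s then a else b, fun t => ?_, fun w => ?_, ?_⟩
  · cases t <;> cases s <;> assumption
  · cases s <;> simp [or_comm]
  · cases s <;> simp [hab, hab.symm]

end IsStackPartition

/-! ### The shape of the odd subgraph. -/

/-- The bricks to which `v` is joined in `F` as the smaller one. -/
noncomputable def parents (𝓑 : Finset Box) (F : Finset (Box × Box)) (v : Box) : Finset Box :=
  open Classical in 𝓑.filter fun u => (u, v) ∈ F

section OddSubgraph

variable {𝓑 : Finset Box} {F : Finset (Box × Box)} (hsub : F ⊆ contacts 𝓑)
include hsub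

theorem mem_parents {u v : Box} : u ∈ parents 𝓑 F v ↔ (u, v) ∈ F := by
  classical
  rw [parents, Finset.mem_filter, and_iff_right_iff_imp]
  exact fun h => (mem_contacts.1 (hsub h)).1

variable [DecidableEq Box]

theorem edgeDegree_eq (v : Box) :
    edgeDegree F v = (children 𝓑 F v).card + (parents 𝓑 F v).card := by
  classical
  rw [edgeDegree_eq_card 𝓑 F fun e he => ⟨(mem_contacts.1 (hsub he)).1,
    (mem_contacts.1 (hsub he)).2.1⟩]
  unfold children parents
  congr!

variable (h𝓑 : IsStackPartition 𝓑)
  (hodd : ∀ v ∈ 𝓑, Even (edgeDegree F v) → edgeDegree F v = 0)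
include h𝓑 hodd

/-- Two parents would occupy both faces of `v` entirely, so its degree would be exactly two, which
is even and not zero. -/
theorem card_parents_le_one {v : Box} (hv : v ∈ 𝓑) : (parents 𝓑 F v).card ≤ 1 := by
  classical
  by_contra! hlt
  obtain ⟨u, hu, u', hu', hne⟩ := Finset.one_lt_card.1 hlt
  rw [mem_parents hsub] at hu hu'
  have hu₁ := hsub hu
  have hu₂ := hsub hu'
  obtain ⟨σ, t⟩ := h𝓑.touchesAt_left hu₁
  obtain ⟨σ', t'⟩ := h𝓑.touchesAt_left hu₂
  have hσ : σ' = !σ := by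
    rw [Bool.eq_not]; rintro rfl
    exact h𝓑.not_touchesAt_of_parent hu₁ (mem_contacts.1 hu₂).1 hne t t'
  subst hσ
  have key : ∀ w ∈ 𝓑, ∀ τ, TouchesAt v w τ → w = u ∨ w = u' := by
    intro w hw τ tw
    by_contra! hcon
    rcases Bool.eq_or_eq_not τ σ with rfl | rfl
    · exact h𝓑.not_touchesAt_of_parent hu₁ hw hcon.1.symm t tw
    · exact h𝓑.not_touchesAt_of_parent hu₂ hw hcon.2.symm t' tw
  have hch : children 𝓑 F v = ∅ := by
    refine Finset.eq_empty_of_forall_notMem fun a ha => ?_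
    have hc := hsub ((mem_children hsub).1 ha)
    obtain ⟨τ, ta⟩ := h𝓑.touchesAt_right hc
    rcases key a (mem_contacts.1 hc).2.1 τ ta with rfl | rfl
    · exact (mem_contacts.1 hc).2.2.not_symm (mem_contacts.1 hu₁).2.2
    · exact (mem_contacts.1 hc).2.2.not_symm (mem_contacts.1 hu₂).2.2
  have hpar : parents 𝓑 F v = {u, u'} := by
    ext w
    rw [Finset.mem_insert, Finset.mem_singleton, mem_parents hsub]
    refine ⟨fun hw => ?_, ?_⟩
    · obtain ⟨τ, tw⟩ := h𝓑.touchesAt_left (hsub hw)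
      exact key w (mem_contacts.1 (hsub hw)).1 τ tw
    · rintro (rfl | rfl) <;> assumption
  have hdeg := edgeDegree_eq hsub v
  rw [hch, hpar, Finset.card_empty, Finset.card_pair hne, zero_add] at hdeg
  have := hodd v hv (hdeg ▸ even_two)
  omega

/-- The parent takes one face, so all children are on the other, where at most two fit. Odd degree
excludes exactly one child. -/
theorem children_of_parent {u v : Box} (huv : (u, v) ∈ F) :
    children 𝓑 F v = ∅ ∨ ∃ (k : Fin 3) (c : Bool → Box),
      (∀ a, a ∈ children 𝓑 F v ↔ ∃ s, a = c s) ∧ (∀ s, FlushAt v (c s) k s) ∧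
        c false ≠ c true := by
  classical
  have huc := hsub huv
  have hv := (mem_contacts.1 huc).2.1
  have hpar : (parents 𝓑 F v).card = 1 := le_antisymm (card_parents_le_one hsub h𝓑 hodd hv)
    (Finset.card_pos.2 ⟨u, (mem_parents hsub).2 huv⟩)
  rcases Finset.eq_empty_or_nonempty (children 𝓑 F v) with hch | hch
  · exact Or.inl hch
  right
  have hdeg := edgeDegree_eq hsub v
  have hpos := Finset.card_pos.2 hch
  have hlt : 1 < (children 𝓑 F v).card := by
    by_contra hle
    have h1 : (children 𝓑 F v).card = 1 := by omega
    rw [h1, hpar] at hdeg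
    have := hodd v hv (hdeg ▸ even_two)
    omega
  obtain ⟨a, ha, b, hb, hab⟩ := Finset.one_lt_card.1 hlt
  obtain ⟨σ, tu⟩ := h𝓑.touchesAt_left huc
  have hside : ∀ w ∈ children 𝓑 F v, (v, w) ∈ contacts 𝓑 ∧ TouchesAt v w (!σ) := by
    intro w hw
    have hc := hsub ((mem_children hsub).1 hw)
    refine ⟨hc, ?_⟩
    obtain ⟨τ, tw⟩ := h𝓑.touchesAt_right hc
    rcases Bool.eq_or_eq_not τ σ with rfl | rfl
    · refine absurd tw (h𝓑.not_touchesAt_of_parent huc (mem_contacts.1 hc).2.1 ?_ tu)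
      rintro rfl
      exact (mem_contacts.1 hc).2.2.not_symm (mem_contacts.1 huc).2.2
    · exact tw
  obtain ⟨ha, ta⟩ := hside a ha
  obtain ⟨hb, tb⟩ := hside b hb
  obtain ⟨k, c, hf, hc, hne⟩ := h𝓑.exists_pair ha hb hab ta tb
  refine ⟨k, c, fun w => ?_, hf, hne⟩
  rw [hc]
  refine ⟨fun hw => ?_, ?_⟩
  · by_contra! hcon
    exact h𝓑.not_three_touchesAt ha hb (hside w hw).1 hab hcon.1.symm hcon.2.symm ta tb
      (hside w hw).2
  · rintro (rfl | rfl) <;> assumption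

/-- Each face carries at most two children; a nonzero odd total is one, or three split as two and
one. -/
theorem children_of_root {v : Box} (hv : v ∈ 𝓑) (hroot : parents 𝓑 F v = ∅) :
    children 𝓑 F v = ∅ ∨ (∃ a, children 𝓑 F v = {a}) ∨ ∃ (k : Fin 3) (c : Bool → Box) (x : Box),
      (∀ s, FlushAt v (c s) k s) ∧ c false ≠ c true ∧ (∀ s, x ≠ c s) ∧
      ∀ a, a ∈ children 𝓑 F v ↔ (∃ s, a = c s) ∨ a = x := by
  classical
  rcases Finset.eq_empty_or_nonempty (children 𝓑 F v) with hch | hch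
  · exact Or.inl hch
  right
  have hdeg := edgeDegree_eq hsub v
  rw [hroot, Finset.card_empty, add_zero] at hdeg
  have hpos := Finset.card_pos.2 hch
  have hnot : ¬ Even (children 𝓑 F v).card := fun h => by
    have := hodd v hv (hdeg ▸ h); omega
  have hcon : ∀ w ∈ children 𝓑 F v, (v, w) ∈ contacts 𝓑 := fun w hw =>
    hsub ((mem_children hsub).1 hw)
  set O := fun σ => (children 𝓑 F v).filter fun w => TouchesAt v w σ with hO
  have hOle : ∀ σ, (O σ).card ≤ 2 := by
    intro σ
    by_contra! hlt
    obtain ⟨a, b, c, ha, hb, hc, hab, hac, hbc⟩ := Finset.two_lt_card_iff.1 hlt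
    simp only [hO, Finset.mem_filter] at ha hb hc
    exact h𝓑.not_three_touchesAt (hcon a ha.1) (hcon b hb.1) (hcon c hc.1) hab hac hbc
      ha.2 hb.2 hc.2
  have hdisj : ∀ σ, Disjoint (O σ) (O (!σ)) := by
    intro σ
    rw [Finset.disjoint_left]
    intro w hw hw'
    simp only [hO, Finset.mem_filter] at hw hw'
    have e := hw.2.level
    have e' := hw'.2.level
    have l := v.lower_lt_upper 2
    have l' := w.lower_lt_upper 2
    cases σ <;> simp at e e' <;> linarith
  have hun : ∀ σ, children 𝓑 F v = O σ ∪ O (!σ) := by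
    intro σ
    ext w
    simp only [hO, Finset.mem_union, Finset.mem_filter, ← and_or_left]
    refine ⟨fun hw => ⟨hw, ?_⟩, fun hw => hw.1⟩
    obtain ⟨τ, tw⟩ := h𝓑.touchesAt_right (hcon w hw)
    rcases Bool.eq_or_eq_not τ σ with rfl | rfl
    · exact Or.inl tw
    · exact Or.inr tw
  have hsum : ∀ σ, (children 𝓑 F v).card = (O σ).card + (O (!σ)).card := fun σ => by
    conv_lhs => rw [hun σ, Finset.card_union_of_disjoint (hdisj σ)]
  have hthree : ∀ σ, (O σ).card = 2 → (O (!σ)).card = 1 → ∃ (k : Fin 3) (c : Bool → Box) (x : Box),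
      (∀ s, FlushAt v (c s) k s) ∧ c false ≠ c true ∧ (∀ s, x ≠ c s) ∧
      ∀ a, a ∈ children 𝓑 F v ↔ (∃ s, a = c s) ∨ a = x := by
    intro σ h2 h1
    obtain ⟨a, b, hab, hOab⟩ := Finset.card_eq_two.1 h2
    obtain ⟨x, hOx⟩ := Finset.card_eq_one.1 h1
    have ha : a ∈ O σ := by simp [hOab]
    have hb : b ∈ O σ := by simp [hOab]
    have ha' := Finset.mem_filter.1 ha
    have hb' := Finset.mem_filter.1 hb
    obtain ⟨k, c, hf, hc, hne⟩ := h𝓑.exists_pair (hcon a ha'.1) (hcon b hb'.1) hab ha'.2 hb'.2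
    refine ⟨k, c, x, hf, hne, fun s hxs => ?_, fun w => ?_⟩
    · have hx : x ∈ O σ := by rw [hOab]; simpa using (hc x).1 ⟨s, hxs⟩
      exact Finset.disjoint_left.1 (hdisj σ) hx (by simp [hOx])
    · rw [hun σ, hOab, hOx, hc]; simp [or_assoc]
  have h1 := hOle true
  have h2 := hOle false
  have h3 := hsum true
  rw [Bool.not_true] at h3
  rw [Nat.even_iff] at hnot
  by_cases hone : (children 𝓑 F v).card = 1
  · exact Or.inl (Finset.card_eq_one.1 hone)
  · right
    rcases (show (O true).card = 2 ∧ (O false).card = 1 ∨ (O false).card = 2 ∧ (O true).card = 1 by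
      omega) with h | h
    · exact hthree true h.1 h.2
    · exact hthree false h.1 h.2

end OddSubgraph

/-! ### Assembling the guards and the final count. -/

theorem IsBrickPartition.isStackPartition {P : Set Point} {𝓑 : Finset Box}
    (h : IsBrickPartition P 𝓑) (hprim : ∀ B ∈ 𝓑, ∀ B' ∈ 𝓑, B ≠ B' →
      (Box.Icc B ∩ Box.Icc B').Nonempty → IsPrimitiveContact B B') : IsStackPartition 𝓑 where
  touch B hB B' hB' hne hn :=
    (h.touch B hB B' hB' hne).resolve_left (Set.not_disjoint_iff_nonempty_inter.2 hn)
  flush B hB B' hB' hne hn := (hprim B hB B' hB' hne hn).flushAt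

namespace IsStackPartition

variable {𝓑 : Finset Box} (h𝓑 : IsStackPartition 𝓑) (hconn : IsConnected (body 𝓑))
include h𝓑 hconn

/-- The bricks reachable from `u` and the unreachable ones have closed unions covering the connected
solid, so these unions meet, and a common point yields a contact. -/
theorem reflTransGen_contacts {u v : Box} (hu : u ∈ 𝓑) (hv : v ∈ 𝓑) :
    Relation.ReflTransGen (fun u v => (u, v) ∈ contacts 𝓑 ∨ (v, u) ∈ contacts 𝓑) u v := by
  classical
  by_contra hcon
  set R := Relation.ReflTransGen (fun u v => (u, v) ∈ contacts 𝓑 ∨ (v, u) ∈ contacts 𝓑) u with hR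
  have hmem : ∀ B : Box, B.upper ∈ Box.Icc B := fun B =>
    mem_box.2 fun i => ⟨(B.lower_lt_upper i).le, le_rfl⟩
  obtain ⟨p, -, hp, hp'⟩ := isPreconnected_closed_iff.1 hconn.isPreconnected
    (body (𝓑.filter R)) (body (𝓑.filter fun w => ¬ R w)) (isClosed_body _) (isClosed_body _)
    (fun p hp => by
      obtain ⟨B, hB, hpB⟩ := mem_body.1 hp
      by_cases hRB : R B
      · exact Or.inl (mem_body.2 ⟨B, by simp [hB, hRB], hpB⟩)
      · exact Or.inr (mem_body.2 ⟨B, by simp [hB, hRB], hpB⟩))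
    ⟨u.upper, mem_body.2 ⟨u, hu, hmem u⟩,
      mem_body.2 ⟨u, Finset.mem_filter.2 ⟨hu, .refl⟩, hmem u⟩⟩
    ⟨v.upper, mem_body.2 ⟨v, hv, hmem v⟩, mem_body.2 ⟨v, Finset.mem_filter.2 ⟨hv, hcon⟩, hmem v⟩⟩
  obtain ⟨B, hB, hpB⟩ := mem_body.1 hp
  obtain ⟨B', hB', hpB'⟩ := mem_body.1 hp'
  rw [Finset.mem_filter] at hB hB'
  refine hB'.2 (hB.2.tail (h𝓑.contact_or hB.1 hB'.1 ?_ ⟨p, hpB, hpB'⟩))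
  rintro rfl
  exact hB'.2 hB.2

/-- Serves the vertex that may be isolated in `F`: it still has a contact in the full graph. -/
theorem exists_guarded_of_two_le (hcard : 2 ≤ 𝓑.card) {v : Box} (hv : v ∈ 𝓑) :
    ∃ G : Finset (Point × Point), (G : Set (Point × Point)) ⊆ contactEdges 𝓑 ∧
      G.card ≤ 1 ∧ Guarded (body 𝓑) G v := by
  obtain ⟨w, hw, hne⟩ := Finset.exists_mem_ne (by omega : 1 < 𝓑.card) v
  rcases (h𝓑.reflTransGen_contacts hconn hv hw).cases_head with h | ⟨a, ha | ha, -⟩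
  · exact absurd h.symm hne
  · obtain ⟨j, s, hf⟩ := (mem_contacts.1 ha).2.2.flush
    exact ⟨{contactEdge v a}, by simpa using ⟨_, ha, rfl⟩, by simp,
      (h𝓑.watches_parent ha hf).guarded (by simp)⟩
  · obtain ⟨j, s, hf⟩ := (mem_contacts.1 ha).2.2.flush
    exact ⟨{contactEdge a v}, by simpa using ⟨_, ha, rfl⟩, by simp,
      (h𝓑.watches_own ha hf).guarded (by simp)⟩

/-- A stack of `b ≥ 2` bricks can be guarded by half of `b`, rounded up, edges of contacts. -/
theorem exists_guards (hcard : 2 ≤ 𝓑.card) :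
    ∃ G : Finset (Point × Point), (G : Set (Point × Point)) ⊆ contactEdges 𝓑 ∧
      2 * G.card ≤ 𝓑.card + 1 ∧ ∀ v ∈ 𝓑, Guarded (body 𝓑) G v := by
  classical
  obtain ⟨F, hsub, heven, hodd⟩ := exists_odd_subgraph 𝓑 (contacts 𝓑)
    (fun e he => ⟨(mem_contacts.1 he).1, (mem_contacts.1 he).2.1, (mem_contacts.1 he).2.2.ne⟩)
    fun u hu v hv => h𝓑.reflTransGen_contacts hconn hu hv
  -- Each brick contributes half its degree rounded down: `1` for a branching with a parent or a
  -- root with three children, `0` for a brick of degree at most one.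
  obtain ⟨cost, hcost⟩ := exists_accumulate (girthRank 𝓑) (children 𝓑 F)
    (fun v c hc => girthRank_lt hsub ((mem_children hsub).1 hc)) fun v => edgeDegree F v / 2
  have hdeg := edgeDegree_eq hsub
  have hF : IsBranching 𝓑 F cost := by
    refine ⟨hsub, fun u v huv => ?_⟩
    have hpar : (parents 𝓑 F v).card = 1 := le_antisymm
      (card_parents_le_one hsub h𝓑 hodd (mem_contacts.1 (hsub huv)).2.1)
      (Finset.card_pos.2 ⟨u, (mem_parents hsub).2 huv⟩)
    refine (children_of_parent hsub h𝓑 hodd huv).imp_right ?_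
    rintro ⟨k, c, hch, hf, hne⟩
    refine ⟨k, c, hch, hf, ?_⟩
    have heq : children 𝓑 F v = {c false, c true} := by
      ext w; rw [hch]; simp
    rw [hcost v, hdeg v, hpar, heq, Finset.card_pair hne, Finset.sum_pair hne]
    omega
  set roots := 𝓑.filter fun v => parents 𝓑 F v = ∅ with hroots
  have hserve : ∀ ρ ∈ roots, ∃ G : Finset (Point × Point),
      (G : Set (Point × Point)) ⊆ contactEdges 𝓑 ∧ G.card ≤ 1 + cost ρ ∧ Serves 𝓑 F G ρ := by
    intro ρ hρ
    obtain ⟨hρ, hpar⟩ := Finset.mem_filter.1 hρ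
    rcases children_of_root hsub h𝓑 hodd hρ hpar with hch | ⟨a, hch⟩ | ⟨k, c, x, hf, hne, hx, hch⟩
    · obtain ⟨G, hG, hc, hg⟩ := h𝓑.exists_guarded_of_two_le hconn hcard hρ
      exact ⟨G, hG, by omega, hF.serves_of_children hg (by simp [hch])⟩
    · refine hF.exists_serves_root_one h𝓑 ((mem_children hsub).1 (by simp [hch] : a ∈ _))
        (by simp [hch]) ?_
      rw [hcost ρ, hch, Finset.sum_singleton]; omega
    · have hcF : ∀ s, (ρ, c s) ∈ F := fun s => (mem_children hsub).1 ((hch _).2 (Or.inl ⟨s, rfl⟩))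
      have hxF : (ρ, x) ∈ F := (mem_children hsub).1 ((hch _).2 (Or.inr rfl))
      obtain ⟨j, s, hfx⟩ := (mem_contacts.1 (hsub hxF)).2.2.flush
      refine hF.exists_serves_root_three h𝓑 hcF hxF (fun b hb => (hch b).1 hb) hf hfx ?_
      have heq : children 𝓑 F ρ = insert x {c false, c true} := by
        ext w; rw [hch]; simp; tauto
      have hnot : x ∉ ({c false, c true} : Finset Box) := by simp [hx]
      rw [hcost ρ, hdeg ρ, hpar, heq, Finset.card_insert_of_notMem hnot, Finset.card_pair hne,
        Finset.sum_insert hnot, Finset.sum_pair hne, Finset.card_empty]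
      omega
  choose! G hG hGc hGs using hserve
  have hdouble : ∑ v ∈ 𝓑, (children 𝓑 F v).card = ∑ v ∈ 𝓑, (parents 𝓑 F v).card := by
    unfold children parents
    convert Finset.sum_card_bipartiteAbove_eq_sum_card_bipartiteBelow
      (s := 𝓑) (t := 𝓑) fun u v => (u, v) ∈ F using 3 <;>
      simp [Finset.bipartiteAbove, Finset.bipartiteBelow]
  have hparents : ∑ v ∈ 𝓑, (parents 𝓑 F v).card + roots.card = 𝓑.card := by
    rw [hroots, Finset.card_filter, ← Finset.sum_add_distrib, Finset.card_eq_sum_ones]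
    refine Finset.sum_congr rfl fun v hv => ?_
    have h1 := card_parents_le_one hsub h𝓑 hodd hv
    split_ifs with h
    · simp [h]
    · have := Finset.card_pos.2 (Finset.nonempty_iff_ne_empty.2 h)
      omega
  -- An odd degree loses one when halved and rounded down, an even degree nothing.
  have hhalf : 2 * ∑ v ∈ 𝓑, edgeDegree F v / 2 + 𝓑.card ≤
      ∑ v ∈ 𝓑, edgeDegree F v + (𝓑.filter fun v => Even (edgeDegree F v)).card := by
    rw [Finset.card_filter, Finset.mul_sum, ← Finset.sum_add_distrib, Finset.card_eq_sum_ones,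
      ← Finset.sum_add_distrib]
    refine Finset.sum_le_sum fun v _ => ?_
    split_ifs with h
    · omega
    · rw [Nat.even_iff] at h; omega
  have hsumdeg : ∑ v ∈ 𝓑, edgeDegree F v =
      ∑ v ∈ 𝓑, (children 𝓑 F v).card + ∑ v ∈ 𝓑, (parents 𝓑 F v).card := by
    rw [← Finset.sum_add_distrib]
    exact Finset.sum_congr rfl fun v _ => hdeg v
  -- Summing the recursion for `cost` over all bricks cancels the cost of every brick that has a
  -- parent, because it occurs in exactly one list of children.
  have hsumcost : ∑ v ∈ roots, cost v = ∑ v ∈ 𝓑, edgeDegree F v / 2 := by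
    have h1 : ∑ v ∈ 𝓑, cost v = ∑ v ∈ 𝓑, edgeDegree F v / 2 +
        ∑ v ∈ 𝓑, ∑ c ∈ children 𝓑 F v, cost c := by
      rw [← Finset.sum_add_distrib]
      exact Finset.sum_congr rfl fun v _ => hcost v
    have h2 : ∑ v ∈ 𝓑, ∑ c ∈ children 𝓑 F v, cost c =
        ∑ c ∈ 𝓑, (parents 𝓑 F c).card * cost c := by
      have h3 : ∀ v, ∑ c ∈ children 𝓑 F v, cost c = ∑ c ∈ 𝓑, if (v, c) ∈ F then cost c else 0 :=
        fun v => by rw [← Finset.sum_filter]; unfold children; congr!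
      simp only [h3]
      rw [Finset.sum_comm]
      refine Finset.sum_congr rfl fun c _ => ?_
      rw [← Finset.sum_filter, Finset.sum_const, smul_eq_mul]
      unfold parents
      congr!
    have h4 : ∑ v ∈ roots, cost v + ∑ c ∈ 𝓑, (parents 𝓑 F c).card * cost c = ∑ v ∈ 𝓑, cost v := by
      rw [hroots, Finset.sum_filter, ← Finset.sum_add_distrib]
      refine Finset.sum_congr rfl fun v hv => ?_
      have h1 := card_parents_le_one hsub h𝓑 hodd hv
      split_ifs with h
      · simp [h]
      · have := Finset.card_pos.2 (Finset.nonempty_iff_ne_empty.2 h)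
        rw [show (parents 𝓑 F v).card = 1 by omega]; simp
    omega
  refine ⟨roots.biUnion G, ?_, ?_, ?_⟩
  · intro e he
    obtain ⟨ρ, hρ, he⟩ := Finset.mem_biUnion.1 (Finset.mem_coe.1 he)
    exact hG ρ hρ he
  · have h1 : (roots.biUnion G).card ≤ ∑ ρ ∈ roots, (1 + cost ρ) :=
      Finset.card_biUnion_le.trans (Finset.sum_le_sum hGc)
    rw [Finset.sum_add_distrib, ← Finset.card_eq_sum_ones] at h1
    omega
  -- Climbing to parents strictly increases the rank, which is bounded by the number of bricks, so
  -- the climb ends at a root.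
  · have hreach : ∀ n, ∀ v ∈ 𝓑, 𝓑.card - girthRank 𝓑 v < n →
        ∃ ρ ∈ roots, Relation.ReflTransGen (fun v a => (v, a) ∈ F) ρ v := by
      intro n
      induction n with
      | zero => intro v _ h; exact absurd h (Nat.not_lt_zero _)
      | succ n ih =>
        intro v hv hn
        rcases Finset.eq_empty_or_nonempty (parents 𝓑 F v) with h | ⟨u, hu⟩
        · exact ⟨v, Finset.mem_filter.2 ⟨hv, h⟩, .refl⟩
        · rw [mem_parents hsub] at hu
          have hle : girthRank 𝓑 u ≤ 𝓑.card := Finset.card_filter_le _ _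
          have hlt := girthRank_lt hsub hu
          obtain ⟨ρ, hρ, h⟩ := ih u (mem_contacts.1 (hsub hu)).1 (by omega)
          exact ⟨ρ, hρ, h.tail hu⟩
    intro v hv
    obtain ⟨ρ, hρ, h⟩ := hreach _ v hv (Nat.lt_succ_self _)
    exact (hGs ρ hρ v h).mono (Finset.subset_biUnion_of_mem G hρ)

end IsStackPartition

theorem IsReflexPoint.mem {P : Set Point} {i : Fin 3} {p : Point} (h : IsReflexPoint P i p) :
    p ∈ P := by
  obtain ⟨j, k, -, -, -, s, t, -, -, h⟩ := h
  exact h.self_of_nhds.2 (by simp)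

theorem OpenGuards.closedGuards {P : Set Point} {G : Finset (Point × Point)} (h : OpenGuards P G) :
    ClosedGuards P G := fun p hp =>
  let ⟨e, he, x, hx, hs⟩ := h p hp
  ⟨e, he, x, openSegment_subset_segment _ _ _ hx, hs⟩

/-- A stack with `r > 0` reflex edges and genus `g` has an open edge guard set of the required
size. -/
theorem IsStack.exists_openGuards {P : Set Point} (hP : IsStack P)
    (hpos : 0 < (reflexEdges P).ncard) {g : ℕ} (hg : HasGenus P g) :
    ∃ G : Finset (Point × Point), (∀ e ∈ G, e ∈ reflexEdges P) ∧
      2 * G.card + g ≤ (reflexEdges P).ncard + 2 ∧ OpenGuards P G := by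
  obtain ⟨𝓑, hpart, hprim⟩ := hP.primitive
  have h𝓑 := hpart.isStackPartition hprim
  have hcover : P = body 𝓑 := hpart.cover
  have hconn := hP.twoReflex.polyhedron.connected
  subst hcover
  obtain ⟨X, hX, hχ⟩ := hg
  rw [h𝓑.boundaryEulerChar_eq hX] at hχ
  have hr := h𝓑.card_contacts_le (Set.finite_of_ncard_pos hpos)
  -- The formula for `χ` says `b - c = 1 - g`, and `c ≤ r`.
  have hgr : g + 𝓑.card ≤ (reflexEdges (body 𝓑)).ncard + 1 := by omega
  rcases le_or_gt 2 𝓑.card with hcard | hcard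
  · obtain ⟨G, hG, hGc, hGs⟩ := h𝓑.exists_guards hconn hcard
    refine ⟨G, fun e he => ?_, by omega, fun p hp => ?_⟩
    · obtain ⟨⟨v, a⟩, hc, rfl⟩ := hG he
      exact h𝓑.contactEdge_mem_reflexEdges hc
    · obtain ⟨B, hB, hpB⟩ := mem_body.1 hp
      exact hGs B hB p hpB
  -- A single brick is convex, so any reflex edge, available from `0 < r`, suffices here; there is
  -- no need to show that this case is void.
  · obtain ⟨e, he⟩ := Set.nonempty_of_ncard_ne_zero hpos.ne'
    obtain ⟨p, hp⟩ := hconn.nonempty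
    obtain ⟨B, hB, -⟩ := mem_body.1 hp
    have hone : 𝓑.card = 1 := by have := Finset.card_pos.2 ⟨B, hB⟩; omega
    obtain ⟨B', rfl⟩ := Finset.card_eq_one.1 hone
    have hconv : Convex ℝ (body {B'}) := by
      simp only [body, Finset.mem_singleton, Set.iUnion_iUnion_eq_left, Box.Icc_def]
      exact convex_Icc _ _
    obtain ⟨i, hei⟩ := id he
    have hmid : midpoint ℝ e.1 e.2 ∈ openSegment ℝ e.1 e.2 := midpoint_mem_openSegment _ _
    refine ⟨{e}, by simpa using he, by rw [Finset.card_singleton]; omega, fun q hq => ?_⟩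
    exact ⟨e, by simp, _, hmid, hconv.segment_subset (hei.reflex _ hmid).mem hq⟩

end StackGuard

theorem lemmal4 (P : Set StackGuard.Point) (hP : StackGuard.IsStack P)
    (r : ℕ) (hr : (StackGuard.reflexEdges P).ncard = r) (hpos : 0 < r)
    (g : ℕ) (hg : StackGuard.HasGenus P g) :
    (∃ G : Finset (StackGuard.Point × StackGuard.Point),
      (∀ e ∈ G, e ∈ StackGuard.reflexEdges P) ∧
      (G.card : ℤ) ≤ ⌊((r : ℚ) - (g : ℚ)) / 2⌋ + 1 ∧
      StackGuard.OpenGuards P G) ∧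
    (∃ G : Finset (StackGuard.Point × StackGuard.Point),
      (∀ e ∈ G, e ∈ StackGuard.reflexEdges P) ∧
      (G.card : ℤ) ≤ ⌊((r : ℚ) - (g : ℚ)) / 2⌋ + 1 ∧
      StackGuard.ClosedGuards P G) := by
  subst hr
  obtain ⟨G, hG, hc, hguard⟩ := hP.exists_openGuards hpos hg
  have hcard : (G.card : ℤ) ≤
      ⌊(((StackGuard.reflexEdges P).ncard : ℚ) - (g : ℚ)) / 2⌋ + 1 := by
    rw [← sub_le_iff_le_add, Int.le_floor]
    have : (2 * G.card + g : ℚ) ≤ (StackGuard.reflexEdges P).ncard + 2 := by exact_mod_cast hc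
    push_cast
    linarith
  exact ⟨⟨G, hG, hcard, hguard⟩, ⟨G, hG, hcard, hguard.closedGuards⟩⟩
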